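/- **Setting.** Let $(x,y)$ have a joint law $P$ on $\mathbb R^d\times\{+1,-1\}$ with class priors $\pi_p=P(y=+1)>0$ and $\pi_n=P(y=-1)>0$, class-conditional laws $p_p,p_n$ of $x$ and marginal law $p=\pi_p p_p+\pi_n p_n$. Let $\ell:\mathbb R\times\{+1,-1\}\to[0,\infty)$ be a loss with $\ell(\cdot,\pm1)$ measurable. For measurable $g:\mathbb R^d\to\mathbb R$ put $\mathcal R(g)=\mathbb E_P[\ell(g(x),y)]$, $\mathcal R_p^+(g)=\mathbb E_{x\sim p_p}[\ell(g(x),+1)]$, and let $\mathcal R^*=\inf_g\mathcal R(g)$ over all measurable $g$. Fix $s\in\{+1,-1\}$, let $\operatorname{sign}(t)=1$ for $t>0$, $-1$ for $t<0$ and $\operatorname{sign}(0)=s$, and put $I(g)=P(\operatorname{sign}(g(x))\ne y)$, $I^*=\inf_g I(g)$ over all measurable $g$. The loss $\ell$ is *classification-calibrated* if for all $\eta\in[0,1]$, $\eta\neq\frac12$, $$\inf_{\alpha\in\mathbb R}\big(\eta\ell(\alpha,+1)+(1-\eta)\ell(\alpha,-1)\big)<\inf_{\alpha:\ \alpha(\eta-\frac12)\le0}\big(\eta\ell(\alpha,+1)+(1-\eta)\ell(\alpha,-1)\big).$$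 Let $n_p,n_n,n_u\ge1$ and let $x^p_1,\dots,x^p_{n_p}\sim p_p$, $x^n_1,\dots,x^n_{n_n}\sim p_n$, $x^u_1,\dots,x^u_{n_u}\sim p$ be independent samples, with empirical means $\hat{\mathcal R}^{\pm}_q(g)=\frac1{n_q}\sum_{i=1}^{n_q}\ell(g(x_i^q),\pm1)$, $q\in\{p,n,u\}$. For $a\in(0,1)$ let $$\hat{\mathcal R}^1_s(g)=\pi_n\hat{\mathcal R}^-_n(g)+(1-a)\pi_p\hat{\mathcal R}^+_p(g)+a\max\{0,\hat{\mathcal R}^+_u(g)-\pi_n\hat{\mathcal R}^+_n(g)\},$$ $$\hat{\mathcal R}^2_s(g)=a\hat{\mathcal R}^+_u(g)+(1-a)\pi_p\hat{\mathcal R}^+_p(g)+\pi_n\hat{\mathcal R}^-_n(g)-a\pi_n\hat{\mathcal R}^+_n(g).$$ Let $\mathcal G$ be a class of measurable functions $g:\mathbb R^d\to\mathbb R$ with $\|g\|_\infty\le C_g$ (suprema over $\mathcal G$ of continuous functions of finitely many values $g(z_1),\dots,g(z_m)$ being universally measurable in $(z_1,\dots,z_m)$), let $C_\ell>0$ with $\ell(t,\pm1)\le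 C_\ell$ for $|t|\le C_g$, and let $\ell(\cdot,\pm1)$ be $L_\ell$-Lipschitz on $\{|t|\le C_g\}$. Let $g^*$ minimize $\mathcal R$ over $\mathcal G$, and let $\hat g^i$ minimize $\hat{\mathcal R}^i_s$ over $\mathcal G$ ($i=1,2$). Let $\mathfrak R_{n,q}(\mathcal G)=\mathbb E_{Z\sim q^n}\mathbb E_\sigma\sup_{g\in\mathcal G}\frac1n\sum_{i=1}^n\sigma_ig(Z_i)$, with independent uniform signs $\sigma_i$, be the Rademacher complexity. Put $$K=(1+a)\pi_n\mathfrak R_{n_n,p_n}(\mathcal G)+(1-a)\pi_p\mathfrak R_{n_p,p_p}(\mathcal G)+a\,\mathfrak R_{n_u,p}(\mathcal G),\qquad r=\frac{(1+a)\pi_n}{\sqrt{n_n}}+\frac{(1-a)\pi_p}{\sqrt{n_p}}+\frac a{\sqrt{n_u}},$$ $$B_1=8L_\ell K+2C_\ell\sqrt{\tfrac{\ln(2/\delta)}2}\,r+2\epsilon,\qquad B_2=4L_\ell K+2C_\ell\sqrt{\tfrac{\ln(6/\delta)}2}\,r,\qquad \epsilon=a\pi_nC_\ell\exp\Big(-\frac{2\pi_p^2\rho^2}{C_\ell^2(1/n_u+\pi_n^2/n_n)}\Big).$$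 **Statement.** If $\ell$ is classification-calibrated, there is a convex, nondecreasing bijection $\psi_\ell:[0,\infty)\to[0,\infty)$ with $\psi_\ell(0)=0$, depending only on $\ell$, such that in the above setting, for every $\delta>0$, the following hold (simultaneously) with probability at least $1-\delta$ over the samples: 1. if $\mathcal G=-\mathcal G$, $\rho>0$ and $\mathcal R_p^+(g)\ge\rho$ for all $g\in\mathcal G$, then $I(\hat g^1)-I^*\le\psi_\ell^{-1}\big(B_1+\mathcal R(g^*)-\mathcal R^*\big)$ for every minimizer $\hat g^1$; 2. $I(\hat g^2)-I^*\le\psi_\ell^{-1}\big(B_2+\mathcal R(g^*)-\mathcal R^*\big)$ for every minimizer $\hat g^2$. Both hold for both choices of $s=\operatorname{sign}(0)$. If $\hat g^i\ne0$ $p$-almost everywhere, the bound also holds when $I$ is the risk of the zero-one loss that equals $0$ if $ty>0$ and $1$ otherwise. -/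

import Mathlib

open Set MeasureTheory ProbabilityTheory
open scoped NNReal ENNReal

noncomputable section

namespace SemiAD

/-- A loss function: `ℓ t y` is the cost of the output `t` when the label is `y ∈ {+1, -1} = ℤˣ`. -/
abbrev Loss := ℝ → ℤˣ → ℝ

/-- All subsets of the label set are measurable. -/
instance : DiscreteMeasurableSpace ℤˣ where
  forall_measurableSet s :=
    ⟨Units.val '' s, MeasurableSet.of_discrete, Set.preimage_image_eq s Units.val_injective⟩

/-! ### Classification calibration -/

/-- The conditional `ℓ`-risk `η ℓ(α,+1) + (1-η) ℓ(α,-1)`. -/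
def condRisk (ℓ : Loss) (η α : ℝ) : ℝ := η * ℓ α 1 + (1 - η) * ℓ α (-1)

/-- `H_ℓ(η)`, the infimum of the conditional risk over all `α ∈ ℝ`. -/
def optCondRisk (ℓ : Loss) (η : ℝ) : ℝ := ⨅ α : ℝ, condRisk ℓ η α

/-- `H_ℓ⁻(η)`, the infimum of the conditional risk over the `α` with `α (η - 1/2) ≤ 0`. -/
def optWrongCondRisk (ℓ : Loss) (η : ℝ) : ℝ :=
  ⨅ α : {α : ℝ // α * (η - 1 / 2) ≤ 0}, condRisk ℓ η α

/-- `ℓ` is classification-calibrated; `η` is a conditional class probability, so `η ∈ [0,1]`. -/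
def ClassificationCalibrated (ℓ : Loss) : Prop :=
  ∀ η ∈ Icc (0 : ℝ) 1, η ≠ 1 / 2 → optCondRisk ℓ η < optWrongCondRisk ℓ η

/-! ### The zero-one loss -/

/-- The zero-one loss that counts the output `0` as an error for both labels. -/
def zeroOneLoss : Loss := fun t y => if 0 < t * ((y : ℤ) : ℝ) then 0 else 1

/-- The zero-one loss of the classifier `sign ∘ g` with the convention `sign 0 = s`. -/
def zeroOneLossTie (s : ℤˣ) : Loss :=
  fun t y => if 0 < t * ((y : ℤ) : ℝ) ∨ (t = 0 ∧ y = s) then 0 else 1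

section Model

variable {X : Type*} [MeasurableSpace X]

/-! ### The joint law of `(x, y)` and its class priors, class-conditional laws and marginal -/

/-- The class prior `π_y`: `prior P 1` is `π_p` and `prior P (-1)` is `π_n`. -/
def prior (P : Measure (X × ℤˣ)) (y : ℤˣ) : ℝ := P.real (Prod.snd ⁻¹' {y})

/-- The law of `x` given the label `y`: `classLaw P 1` is `p_p`, `classLaw P (-1)` is `p_n`. -/
def classLaw (P : Measure (X × ℤˣ)) (y : ℤˣ) : Measure X :=
  (ProbabilityTheory.cond P (Prod.snd ⁻¹' {y})).map Prod.fst

/-- The marginal law `p` of `x`. -/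
def marginal (P : Measure (X × ℤˣ)) : Measure X := P.map Prod.fst

/-! ### Risks -/

/-- The risk `E_{(x,y) ∼ P} ℓ(g(x), y)` of a nonnegative loss, as an extended nonnegative number
(so that it is `∞`, and not `0`, when the loss is not integrable). -/
def risk (P : Measure (X × ℤˣ)) (ℓ : Loss) (g : X → ℝ) : ℝ≥0∞ :=
  ∫⁻ z, ENNReal.ofReal (ℓ (g z.1) z.2) ∂P

/-- The infimum of the risk over all measurable functions. -/
def bayesRisk (P : Measure (X × ℤˣ)) (ℓ : Loss) : ℝ≥0∞ :=
  ⨅ (g : X → ℝ) (_ : Measurable g), risk P ℓ g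

/-- The excess risk of `g` over the infimum over all measurable functions (as a real number;
used for functions of finite risk only). -/
def excessRisk (P : Measure (X × ℤˣ)) (ℓ : Loss) (g : X → ℝ) : ℝ :=
  (risk P ℓ g).toReal - (bayesRisk P ℓ).toReal

/-- The expectation of `ℓ(g(x), y)` for a fixed label `y` and `x ∼ q`. -/
def partialRisk (q : Measure X) (ℓ : Loss) (y : ℤˣ) (g : X → ℝ) : ℝ := ∫ x, ℓ (g x) y ∂q

/-! ### Samples and empirical risks -/

/-- A triple of a positive, a negative and an unlabeled sample, of sizes `np`, `nn`, `nu`. -/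
abbrev Samples (X : Type*) (np nn nu : ℕ) := (Fin np → X) × (Fin nn → X) × (Fin nu → X)

/-- The law of the samples: all points are independent, with laws `p_p`, `p_n` and `p`. -/
def sampleLaw (P : Measure (X × ℤˣ)) (np nn nu : ℕ) : Measure (Samples X np nn nu) :=
  (Measure.pi fun _ : Fin np => classLaw P 1).prod
    ((Measure.pi fun _ : Fin nn => classLaw P (-1)).prod
      (Measure.pi fun _ : Fin nu => marginal P))

/-- The empirical mean of `ℓ(g(x_i), y)` for a fixed label `y`. -/
def empMean (ℓ : Loss) (y : ℤˣ) {n : ℕ} (x : Fin n → X) (g : X → ℝ) : ℝ :=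
  (1 / (n : ℝ)) * ∑ i, ℓ (g (x i)) y

/-- The nonnegative risk estimator
`π_n R̂_n⁻(g) + (1-a) π_p R̂_p⁺(g) + a max {0, R̂_u⁺(g) - π_n R̂_n⁺(g)}`. -/
def empRisk1 (P : Measure (X × ℤˣ)) (ℓ : Loss) (a : ℝ) {np nn nu : ℕ}
    (S : Samples X np nn nu) (g : X → ℝ) : ℝ :=
  prior P (-1) * empMean ℓ (-1) S.2.1 g + (1 - a) * prior P 1 * empMean ℓ 1 S.1 g
    + a * max 0 (empMean ℓ 1 S.2.2 g - prior P (-1) * empMean ℓ 1 S.2.1 g)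

/-- The unbiased risk estimator
`a R̂_u⁺(g) + (1-a) π_p R̂_p⁺(g) + π_n R̂_n⁻(g) - a π_n R̂_n⁺(g)`. -/
def empRisk2 (P : Measure (X × ℤˣ)) (ℓ : Loss) (a : ℝ) {np nn nu : ℕ}
    (S : Samples X np nn nu) (g : X → ℝ) : ℝ :=
  a * empMean ℓ 1 S.2.2 g + (1 - a) * prior P 1 * empMean ℓ 1 S.1 g
    + prior P (-1) * empMean ℓ (-1) S.2.1 g - a * prior P (-1) * empMean ℓ 1 S.2.1 g

/-! ### Function classes -/

/-- Suprema over `𝒢` of continuous functions of finitely many values `g(z_1), …, g(z_m)` are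
universally measurable in `(z_1, …, z_m)`. This is the usual measurability convention under which
Rademacher complexities are defined. -/
def MeasurableSuprema (𝒢 : Set (X → ℝ)) : Prop :=
  ∀ (m : ℕ) (F : (Fin m → ℝ) → ℝ), Continuous F →
    ∀ (ν : Measure (Fin m → X)) [IsProbabilityMeasure ν],
      AEMeasurable (fun z => ⨆ g : 𝒢, F fun i => g.1 (z i)) ν

/-- The Rademacher complexity of `𝒢` for samples of size `n` from `q`; the expectation over the
uniform random signs is the average over the `2 ^ n` sign vectors. -/
def rademacher (n : ℕ) (q : Measure X) (𝒢 : Set (X → ℝ)) : ℝ :=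
  ∫ z : Fin n → X,
    (1 / (2 : ℝ) ^ n) * ∑ σ : Fin n → ℤˣ,
      ⨆ g : 𝒢, (1 / (n : ℝ)) * ∑ i, ((σ i : ℤ) : ℝ) * g.1 (z i)
    ∂(Measure.pi fun _ : Fin n => q)

/-! ### The right-hand sides of the two estimation error bounds -/

/-- `(1+a) π_n / √n_n + (1-a) π_p / √n_p + a / √n_u`. -/
def rateSum (P : Measure (X × ℤˣ)) (a : ℝ) (np nn nu : ℕ) : ℝ :=
  (1 + a) * prior P (-1) / √(nn : ℝ) + (1 - a) * prior P 1 / √(np : ℝ) + a / √(nu : ℝ)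

/-- `(1+a) π_n ℜ_{n_n,p_n}(𝒢) + (1-a) π_p ℜ_{n_p,p_p}(𝒢) + a ℜ_{n_u,p}(𝒢)`. -/
def rademacherSum (P : Measure (X × ℤˣ)) (𝒢 : Set (X → ℝ)) (a : ℝ) (np nn nu : ℕ) : ℝ :=
  (1 + a) * prior P (-1) * rademacher nn (classLaw P (-1)) 𝒢
    + (1 - a) * prior P 1 * rademacher np (classLaw P 1) 𝒢
    + a * rademacher nu (marginal P) 𝒢

/-- `ε = a π_n C_ℓ exp (- 2 π_p² ρ² / (C_ℓ² (1/n_u + π_n²/n_n)))`. -/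
def biasTerm (P : Measure (X × ℤˣ)) (a Cl ρ : ℝ) (nn nu : ℕ) : ℝ :=
  a * prior P (-1) * Cl *
    Real.exp (-(2 * prior P 1 ^ 2 * ρ ^ 2 /
      (Cl ^ 2 * (1 / (nu : ℝ) + prior P (-1) ^ 2 / (nn : ℝ)))))

/-- `B₁`. -/
def bound1 (P : Measure (X × ℤˣ)) (𝒢 : Set (X → ℝ)) (a Cl L ρ δ : ℝ) (np nn nu : ℕ) : ℝ :=
  8 * L * rademacherSum P 𝒢 a np nn nu
    + 2 * Cl * √(Real.log (2 / δ) / 2) * rateSum P a np nn nu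
    + 2 * biasTerm P a Cl ρ nn nu

/-- `B₂`. -/
def bound2 (P : Measure (X × ℤˣ)) (𝒢 : Set (X → ℝ)) (a Cl L δ : ℝ) (np nn nu : ℕ) : ℝ :=
  4 * L * rademacherSum P 𝒢 a np nn nu
    + 2 * Cl * √(Real.log (6 / δ) / 2) * rateSum P a np nn nu

/-- The excess zero-one risk of `g` is at most `b`: for both conventions for `sign 0`, and, if `g`
almost surely does not vanish, also with the output `0` counted as an error for both labels. -/
def ExcessZeroOneRiskLE (P : Measure (X × ℤˣ)) (g : X → ℝ) (b : ℝ) : Prop :=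
  (∀ s : ℤˣ, excessRisk P (zeroOneLossTie s) g ≤ b) ∧
    ((∀ᵐ x ∂(marginal P), g x ≠ 0) → excessRisk P zeroOneLoss g ≤ b)

end Model

end SemiAD

end

/-! The proof combines a calibration inequality, which depends on the loss alone, with a one-sided
estimation bound.

Calibration. Let `H(η)` and `H⁻(η)` be the optimal conditional risk and the optimal one over outputs
on the wrong side. Calibration says that the gap `H⁻ - H` is positive off `1/2`. The gap is lower
semicontinuous there, so on each compact set `|2η - 1| ≥ θ₀` it has a positive lower bound
(`exists_gap_lower_bound`). A supremum of ramps with small slopes is then a convex bijection `ψ`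
with `ψ(|2η - 1|) ≤ H⁻(η) - H(η)` (`exists_convex_minorant`). The excess zero-one risk of `g` is at
most the integral of `|2η(x) - 1|` over the points where `g` is on the wrong side. By Jensen, `ψ` of
this integral is at most the excess `ℓ`-risk (`map_integral_wrongMargin_le`).

Estimation. Write `R̂¹`, `R̂²` for the two estimators and `V(S) = E_T sup_g (R̂²_T(g) - R̂²_S(g))`,
with `T` a ghost sample. Since `R̂²` is unbiased, `R(g) ≤ R̂²_S(g) + V(S)` on the whole class. Since
`R̂² ≤ R̂¹`, a minimizer of `R̂ⁱ` satisfies `R(ĝ) ≤ V(S) + R̂ⁱ_S(g*)` for both `i`. The right-hand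
side is a single statistic whose increments are at most twice those of the empirical risk, so one
application of the bounded differences inequality controls it. Its mean is at most `R(g*) + 2LK`, by
symmetrization and contraction, plus, for `i = 1`, the bias of `R̂¹` at the single function `g*`.
That bias is exponentially small because clipping is active only when a mean with expectation at
most `-π_p ρ` becomes nonnegative.

Suprema over the class are only universally measurable, so concentration is proved for that class of
functions, which is stable under partial integration. -/

noncomputable section

namespace SemiAD

/-! ### Universally measurable functions -/

/-- `f` is universally measurable: almost everywhere measurable for every probability measure. -/
def UnivMeas {Ω : Type*} [MeasurableSpace Ω] (f : Ω → ℝ) : Prop :=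
  ∀ (ν : Measure Ω) [IsProbabilityMeasure ν], AEMeasurable f ν

section UnivMeas

variable {Ω Ω' : Type*} [MeasurableSpace Ω] [MeasurableSpace Ω']

lemma UnivMeas.of_measurable {f : Ω → ℝ} (hf : Measurable f) : UnivMeas f :=
  fun _ _ => hf.aemeasurable

lemma UnivMeas.comp {f : Ω → ℝ} (hf : UnivMeas f) {g : Ω' → Ω} (hg : Measurable g) :
    UnivMeas fun x => f (g x) := fun ν _ => by
  have := Measure.isProbabilityMeasure_map (μ := ν) hg.aemeasurable
  exact (hf (ν.map g)).comp_measurable hg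

lemma UnivMeas.add {f g : Ω → ℝ} (hf : UnivMeas f) (hg : UnivMeas g) :
    UnivMeas fun x => f x + g x := fun ν _ => (hf ν).add (hg ν)

lemma UnivMeas.integrable {f : Ω → ℝ} (hf : UnivMeas f) {M : ℝ} (hM : ∀ x, |f x| ≤ M)
    (ν : Measure Ω) [IsProbabilityMeasure ν] : Integrable f ν :=
  Integrable.of_bound (hf ν).aestronglyMeasurable M (ae_of_all _ hM)

/-- Measurability must hold for all measures at once: the partial integral is handled for `ν`
through the product `ν.prod μ`. -/
lemma UnivMeas.integral_right {f : Ω × Ω' → ℝ} (hf : UnivMeas f) (μ : Measure Ω')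
    [IsProbabilityMeasure μ] : UnivMeas fun x => ∫ y, f (x, y) ∂μ := fun ν _ =>
  ((hf (ν.prod μ)).aestronglyMeasurable.integral_prod_right').aemeasurable

lemma abs_integral_le_of_bound {f : Ω → ℝ} {M : ℝ} (hM : ∀ x, |f x| ≤ M)
    (ν : Measure Ω) [IsProbabilityMeasure ν] : |∫ x, f x ∂ν| ≤ M := by
  have := norm_integral_le_of_norm_le_const (f := f) (μ := ν) (ae_of_all _ hM)
  simpa using this

end UnivMeas

/-! ### The bounded differences inequality -/

/-- Bounded universally measurable functions whose increments are dominated by `D` have centered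
moment generating functions bounded by that of a Gaussian of variance `v`. -/
def Concentrates {Ω : Type*} [MeasurableSpace Ω] (μ : Measure Ω) (D : Ω → Ω → ℝ) (v : ℝ) : Prop :=
  ∀ f : Ω → ℝ, UnivMeas f → (∃ M, ∀ x, |f x| ≤ M) → (∀ x y, f x - f y ≤ D x y) →
    ∀ t : ℝ, ∫ x, Real.exp (t * (f x - ∫ y, f y ∂μ)) ∂μ ≤ Real.exp (v * t ^ 2 / 2)

section Concentrates

variable {Ω Ω' : Type*} [MeasurableSpace Ω] [MeasurableSpace Ω']

lemma integrable_exp_centered {f : Ω → ℝ} (hf : UnivMeas f) {M : ℝ} (hM : ∀ x, |f x| ≤ M)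
    (t m : ℝ) (μ : Measure Ω) [IsProbabilityMeasure μ] :
    Integrable (fun x => Real.exp (t * (f x - m))) μ := by
  refine Integrable.of_bound (C := Real.exp (|t| * (M + |m|))) ?_ (ae_of_all _ fun x => ?_)
  · have := hf μ
    exact (Real.measurable_exp.comp_aemeasurable
      ((this.sub_const m).const_mul t)).aestronglyMeasurable
  · rw [Real.norm_eq_abs, Real.abs_exp, Real.exp_le_exp]
    calc t * (f x - m) ≤ |t * (f x - m)| := le_abs_self _
      _ = |t| * |f x - m| := abs_mul _ _
      _ ≤ |t| * (M + |m|) := by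
        gcongr
        exact (abs_sub _ _).trans (by gcongr; exact hM x)

/-- Hoeffding's lemma. -/
lemma concentrates_const (μ : Measure Ω) [IsProbabilityMeasure μ] {D : Ω → Ω → ℝ} {c : ℝ}
    (hD : ∀ x y, D x y ≤ c) : Concentrates μ D (c ^ 2 / 4) := by
  intro f hf ⟨M, hM⟩ hfD t
  have hne : Nonempty Ω := μ.nonempty_of_neZero
  have hbdd : BddBelow (range f) := ⟨-M, by rintro _ ⟨x, rfl⟩; exact (abs_le.1 (hM x)).1⟩
  -- Increments of at most `c` confine `f` to an interval of length `c` starting at its infimum.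
  have hmem : ∀ x, f x ∈ Icc (⨅ x, f x) ((⨅ x, f x) + c) := fun x =>
    ⟨ciInf_le hbdd x, by
      have : f x - c ≤ ⨅ x, f x := le_ciInf fun y => by linarith [hfD x y, hD x y]
      linarith⟩
  have h := (hasSubgaussianMGF_of_mem_Icc (hf μ) (ae_of_all _ hmem)).mgf_le t
  refine h.trans_eq ?_
  congr 1
  push_cast
  rw [add_sub_cancel_left, Real.norm_eq_abs, div_pow, sq_abs]
  ring

lemma Concentrates.mono {μ : Measure Ω} {D D' : Ω → Ω → ℝ} {v v' : ℝ} (h : Concentrates μ D v)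
    (hD : ∀ x y, D' x y ≤ D x y) (hv : v ≤ v') : Concentrates μ D' v' := fun f hf hM hfD t =>
  (h f hf hM (fun x y => (hfD x y).trans (hD x y)) t).trans (by gcongr)

/-- Tensorization by conditioning: with `F x` the mean of `f (x, ·)`, write `f - m = (F - m) + (f -
F)`. For fixed `x` the second summand only sees `D'`, because `D x x = 0`. Averaging over the second
variable gives `F` the increments `D`, because `D'` vanishes on the diagonal. -/
lemma Concentrates.prod {μ : Measure Ω} {μ' : Measure Ω'} [IsProbabilityMeasure μ]
    [IsProbabilityMeasure μ'] {D : Ω → Ω → ℝ} {D' : Ω' → Ω' → ℝ} {v v' : ℝ}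
    (h : Concentrates μ D v) (h' : Concentrates μ' D' v') (hD : ∀ x, D x x = 0)
    (hD' : ∀ x, D' x x = 0) :
    Concentrates (μ.prod μ') (fun z w => D z.1 w.1 + D' z.2 w.2) (v + v') := by
  intro f hf ⟨M, hM⟩ hfD t
  set F : Ω → ℝ := fun x => ∫ y, f (x, y) ∂μ' with hF
  have hsec : ∀ x, UnivMeas fun y => f (x, y) := fun x => hf.comp measurable_prodMk_left
  have hFm : UnivMeas F := hf.integral_right μ'
  have hFM : ∀ x, |F x| ≤ M := fun x => abs_integral_le_of_bound (fun y => hM (x, y)) μ'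
  have hFD : ∀ x y, F x - F y ≤ D x y := fun x y => by
    rw [hF]
    simp only
    rw [← integral_sub ((hsec x).integrable (fun z => hM (x, z)) μ')
      ((hsec y).integrable (fun z => hM (y, z)) μ')]
    refine (integral_mono (((hsec x).integrable (fun z => hM (x, z)) μ').sub
      ((hsec y).integrable (fun z => hM (y, z)) μ')) (integrable_const (D x y)) fun z => ?_).trans
      (by simp)
    have := hfD (x, z) (y, z)
    simp only [hD', add_zero] at this
    exact this
  have hmean : ∫ z, f z ∂(μ.prod μ') = ∫ x, F x ∂μ := integral_prod _ (hf.integrable hM _)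
  rw [hmean]
  set m := ∫ x, F x ∂μ
  rw [integral_prod _ (integrable_exp_centered hf hM t m _)]
  calc ∫ x, ∫ y, Real.exp (t * (f (x, y) - m)) ∂μ' ∂μ
      ≤ ∫ x, Real.exp (t * (F x - m)) * Real.exp (v' * t ^ 2 / 2) ∂μ := by
        refine integral_mono (integrable_exp_centered hf hM t m _).integral_prod_left
          ((integrable_exp_centered hFm hFM t m μ).mul_const _) fun x => ?_
        have hx : ∀ y, Real.exp (t * (f (x, y) - m)) =
            Real.exp (t * (F x - m)) * Real.exp (t * (f (x, y) - F x)) := fun y => by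
          rw [← Real.exp_add]; congr 1; ring
        simp only [hx]
        rw [integral_const_mul]
        gcongr
        refine h' _ (hsec x) ⟨M, fun y => hM (x, y)⟩ (fun y z => ?_) t
        have := hfD (x, y) (x, z)
        simp only [hD, zero_add] at this
        exact this
    _ ≤ Real.exp (v * t ^ 2 / 2) * Real.exp (v' * t ^ 2 / 2) := by
        rw [integral_mul_const]
        gcongr
        exact h F hFm ⟨M, hFM⟩ hFD t
    _ = Real.exp ((v + v') * t ^ 2 / 2) := by
        rw [← Real.exp_add]; congr 1; ring

lemma Concentrates.of_measurePreserving {μ : Measure Ω} {μ' : Measure Ω'} {D : Ω → Ω → ℝ} {v : ℝ}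
    [IsProbabilityMeasure μ] (h : Concentrates μ D v) {e : Ω → Ω'} (he : MeasurePreserving e μ μ')
    {D' : Ω' → Ω' → ℝ} (hD : ∀ x y, D' (e x) (e y) ≤ D x y) : Concentrates μ' D' v := by
  intro f hf ⟨M, hM⟩ hfD t
  have : IsProbabilityMeasure μ' := by
    rw [← he.map_eq]; exact Measure.isProbabilityMeasure_map he.measurable.aemeasurable
  have := h (fun x => f (e x)) (hf.comp he.measurable) ⟨M, fun x => hM _⟩
    (fun x y => (hfD _ _).trans (hD x y)) t
  rw [← he.map_eq, integral_map he.measurable.aemeasurable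
    (by rw [he.map_eq]; exact (integrable_exp_centered hf hM t _ μ').aestronglyMeasurable),
    integral_map he.measurable.aemeasurable
      (by rw [he.map_eq]; exact (hf μ').aestronglyMeasurable)]
  exact this

open Classical in
/-- The weighted Hamming distance. -/
def weightedHamming {X : Type*} {n : ℕ} (c : ℝ) (x y : Fin n → X) : ℝ :=
  ∑ i, if x i = y i then 0 else c

lemma weightedHamming_self {X : Type*} {n : ℕ} (c : ℝ) (x : Fin n → X) :
    weightedHamming c x x = 0 := by simp [weightedHamming]

/-- Each coordinate contributes Hoeffding's `c ^ 2 / 4`, and `Concentrates.prod` adds these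
contributions as the coordinates are split off one by one. -/
lemma concentrates_pi {X : Type*} [MeasurableSpace X] (q : Measure X) [IsProbabilityMeasure q]
    {c : ℝ} (hc : 0 ≤ c) (n : ℕ) :
    Concentrates (Measure.pi fun _ : Fin n => q) (weightedHamming c) (n * c ^ 2 / 4) := by
  classical
  induction n with
  | zero =>
    refine (concentrates_const _ (c := 0) fun x y => ?_).mono (fun _ _ => le_rfl) (by simp)
    simp [weightedHamming]
  | succ n ih =>
    have h1 : Concentrates q (fun x y => if x = y then 0 else c) (c ^ 2 / 4) :=
      concentrates_const q fun x y => by split_ifs <;> simp [hc]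
    have h2 := h1.prod ih (by simp) (weightedHamming_self c)
    have hmp := (measurePreserving_piFinSuccAbove (fun _ : Fin (n + 1) => q) 0).symm
    refine (h2.of_measurePreserving hmp fun x y => ?_).mono (fun _ _ => le_rfl)
      (by push_cast; linarith)
    simp [weightedHamming, Fin.sum_univ_succ, MeasurableEquiv.piFinSuccAbove]

/-- **McDiarmid's inequality**, in abstract form. -/
lemma Concentrates.measure_ge_le {μ : Measure Ω} [IsProbabilityMeasure μ] {D : Ω → Ω → ℝ} {v : ℝ}
    (h : Concentrates μ D v) (hv : 0 ≤ v) {f : Ω → ℝ} (hf : UnivMeas f) {M : ℝ}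
    (hM : ∀ x, |f x| ≤ M) (hfD : ∀ x y, f x - f y ≤ D x y) {s : ℝ} (hs : 0 ≤ s) :
    μ.real {x | ∫ y, f y ∂μ + s ≤ f x} ≤ Real.exp (-s ^ 2 / (2 * v)) := by
  have hsub : HasSubgaussianMGF (fun x => f x - ∫ y, f y ∂μ) ⟨v, hv⟩ μ :=
    ⟨fun t => integrable_exp_centered hf hM t _ μ, fun t => h f hf ⟨M, hM⟩ hfD t⟩
  refine le_trans (le_of_eq ?_) (hsub.measure_ge_le hs)
  congr 1
  ext x
  simp only [mem_ofPred_eq]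
  constructor <;> intro <;> linarith

end Concentrates

/-! ### The calibration function -/

/-- A family of positive values `γ i` that is bounded below by a positive constant on each
`{i | θ₀ ≤ θ i}` dominates a convex increasing bijection of `θ i`. -/
lemma exists_convex_minorant {ι : Type*} (θ γ : ι → ℝ) (hθ : ∀ i, θ i ∈ Icc (0 : ℝ) 1)
    (hγ0 : ∀ i, 0 ≤ γ i) (hγ : ∀ θ₀ ∈ Ioc (0 : ℝ) 1, ∃ m > 0, ∀ i, θ₀ ≤ θ i → m ≤ γ i) :
    ∃ ψ : ℝ → ℝ, ConvexOn ℝ (Ici 0) ψ ∧ StrictMonoOn ψ (Ici 0) ∧ ContinuousOn ψ (Ici 0) ∧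
      BijOn ψ (Ici 0) (Ici 0) ∧ ψ 0 = 0 ∧ ∀ i, ψ (θ i) ≤ γ i := by
  choose! m₀ hm₀ hm₀γ using hγ
  -- Capping the slopes at `1` keeps the supremum of the ramps finite and makes `ψ` 1-Lipschitz.
  set m : ℝ → ℝ := fun u => min (m₀ u) 1 with hm
  have hmpos : ∀ u ∈ Ioc (0 : ℝ) 1, 0 < m u := fun u hu => lt_min (hm₀ u hu) one_pos
  have hm1 : ∀ u, m u ≤ 1 := fun u => min_le_right _ _
  set ψ : ℝ → ℝ := fun t => ⨆ u : Ioc (0 : ℝ) 1, m u * max 0 (t - (u : ℝ)) with hψ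
  have hne : Nonempty (Ioc (0 : ℝ) 1) := ⟨⟨1, one_pos, le_rfl⟩⟩
  have hterm : ∀ t, ∀ u : Ioc (0 : ℝ) 1, m u * max 0 (t - (u : ℝ)) ≤ max 0 t := fun t u => by
    calc m u * max 0 (t - (u : ℝ)) ≤ 1 * max 0 (t - (u : ℝ)) := by gcongr; exact hm1 _
      _ ≤ max 0 t := by rw [one_mul]; exact max_le_max le_rfl (by linarith [u.2.1])
  have hbdd : ∀ t, BddAbove (range fun u : Ioc (0 : ℝ) 1 => m u * max 0 (t - (u : ℝ))) := fun t =>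
    ⟨max 0 t, by rintro _ ⟨u, rfl⟩; exact hterm t u⟩
  have hle : ∀ t, ∀ u ∈ Ioc (0 : ℝ) 1, m u * (t - u) ≤ ψ t := fun t u hu =>
    (mul_le_mul_of_nonneg_left (le_max_right _ _) (hmpos u hu).le).trans
      (le_ciSup (hbdd t) ⟨u, hu⟩)
  have hψ0 : ψ 0 = 0 := by
    have : ∀ u : Ioc (0 : ℝ) 1, m u * max 0 (0 - (u : ℝ)) = 0 := fun u => by
      rw [max_eq_left (by linarith [u.2.1]), mul_zero]
    simp only [hψ, this, ciSup_const]
  have hψpos : ∀ t, 0 < t → 0 < ψ t := fun t ht => by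
    have hu : min t 1 / 2 ∈ Ioc (0 : ℝ) 1 :=
      ⟨by positivity, by linarith [min_le_right t 1]⟩
    exact (mul_pos (hmpos _ hu) (by linarith [min_le_left t 1])).trans_le (hle t _ hu)
  have hconv : ConvexOn ℝ (Ici 0) ψ := by
    refine ⟨convex_Ici 0, fun x _ y _ a b ha hb hab => ciSup_le fun u => ?_⟩
    have hx := le_ciSup (hbdd x) u
    have hy := le_ciSup (hbdd y) u
    have hmax : max 0 (a • x + b • y - (u : ℝ)) ≤ a * max 0 (x - (u : ℝ)) + b * max 0 (y - (u : ℝ)) := by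
      refine max_le (by positivity) ?_
      have : a • x + b • y - (u : ℝ) = a * (x - u) + b * (y - u) := by
        simp only [smul_eq_mul]; linear_combination (-(u : ℝ)) * (hab.symm)
      rw [this]
      gcongr <;> exact le_max_right _ _
    calc m u * max 0 (a • x + b • y - (u : ℝ))
        ≤ m u * (a * max 0 (x - (u : ℝ)) + b * max 0 (y - (u : ℝ))) :=
          mul_le_mul_of_nonneg_left hmax (hmpos u u.2).le
      _ = a * (m u * max 0 (x - (u : ℝ))) + b * (m u * max 0 (y - (u : ℝ))) := by ring
      _ ≤ a • ψ x + b • ψ y := by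
        simp only [smul_eq_mul]; gcongr
  have hmono : StrictMonoOn ψ (Ici 0) := by
    intro s hs t ht hst
    have ht0 : 0 < t := lt_of_le_of_lt hs hst
    -- Convexity on the chord from `0` to `t` gives `ψ s ≤ (s / t) ψ t`, which is less than `ψ t`.
    have h := hconv.2 (mem_Ici.2 le_rfl) ht
      (show (0 : ℝ) ≤ 1 - s / t by rw [sub_nonneg, div_le_one ht0]; exact hst.le)
      (div_nonneg hs ht0.le) (by ring)
    simp only [smul_eq_mul, mul_zero, zero_add, hψ0, div_mul_cancel₀ _ ht0.ne'] at h
    exact h.trans_lt (mul_lt_of_lt_one_left (hψpos t ht0) ((div_lt_one ht0).2 hst))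
  have hlip : LipschitzWith 1 ψ := by
    refine LipschitzWith.of_le_add fun x y => ciSup_le fun u => ?_
    have hy := le_ciSup (hbdd y) u
    have : max 0 (x - (u : ℝ)) ≤ max 0 (y - (u : ℝ)) + dist x y := by
      refine max_le (by positivity) ?_
      have := le_max_right 0 (y - (u : ℝ))
      have := le_abs_self (x - y)
      rw [Real.dist_eq]; linarith
    calc m u * max 0 (x - (u : ℝ)) ≤ m u * (max 0 (y - (u : ℝ)) + dist x y) :=
          mul_le_mul_of_nonneg_left this (hmpos u u.2).le
      _ = m u * max 0 (y - (u : ℝ)) + m u * dist x y := by ring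
      _ ≤ ψ y + 1 * dist x y := by gcongr; exact hm1 _
      _ = _ := by rw [one_mul]
  refine ⟨ψ, hconv, hmono, hlip.continuous.continuousOn, ⟨?_, hmono.injOn, ?_⟩, hψ0, fun i => ?_⟩
  · intro t ht
    rcases (mem_Ici.1 ht).eq_or_lt with h | h
    · rw [← h, hψ0]; exact mem_Ici.2 le_rfl
    · exact (hψpos t h).le
  · intro y hy
    have h1 : (1 : ℝ) ∈ Ioc (0 : ℝ) 1 := ⟨one_pos, le_rfl⟩
    have hm1pos := hmpos 1 h1
    -- The ramp starting at `1` alone already makes `ψ` unbounded, so the intermediate value theorem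
    -- reaches every `y`.
    have hb : y ≤ ψ (y / m 1 + 1) := by
      refine le_trans (le_of_eq ?_) (hle (y / m 1 + 1) 1 h1)
      field_simp; ring
    have h0 : (0 : ℝ) ≤ y / m 1 + 1 := by have := div_nonneg (mem_Ici.1 hy) hm1pos.le; linarith
    obtain ⟨t, ht, rfl⟩ := intermediate_value_Icc h0 hlip.continuous.continuousOn
      ⟨by rw [hψ0]; exact hy, hb⟩
    exact ⟨t, ht.1, rfl⟩
  · refine ciSup_le fun u => ?_
    -- A ramp that has started by `θ i` is at most its slope there, because `θ i - u ≤ 1`; the slope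
    -- is a lower bound for `γ i`. The other ramps vanish.
    rcases le_total (u : ℝ) (θ i) with h | h
    · rw [max_eq_right (by linarith)]
      calc m u * (θ i - u) ≤ m u * 1 := by
            gcongr
            · exact (hmpos u u.2).le
            · linarith [(hθ i).2, u.2.1]
        _ ≤ γ i := by
            rw [mul_one]; exact (min_le_left _ _).trans (hm₀γ u u.2 i h)
    · rw [max_eq_left (by linarith), mul_zero]; exact hγ0 i

/-! ### The calibration gap is bounded away from zero off `1/2` -/

section Gap

variable {ℓ : Loss}

lemma condRisk_nonneg (hnonneg : ∀ t y, 0 ≤ ℓ t y) {η : ℝ} (hη : η ∈ Icc (0 : ℝ) 1) (α : ℝ) :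
    0 ≤ condRisk ℓ η α :=
  add_nonneg (mul_nonneg hη.1 (hnonneg _ _)) (mul_nonneg (sub_nonneg.2 hη.2) (hnonneg _ _))

lemma bddBelow_condRisk (hnonneg : ∀ t y, 0 ≤ ℓ t y) {η : ℝ} (hη : η ∈ Icc (0 : ℝ) 1) :
    BddBelow (range fun α => condRisk ℓ η α) :=
  ⟨0, by rintro _ ⟨α, rfl⟩; exact condRisk_nonneg hnonneg hη α⟩

lemma optCondRisk_le (hnonneg : ∀ t y, 0 ≤ ℓ t y) {η : ℝ} (hη : η ∈ Icc (0 : ℝ) 1) (α : ℝ) :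
    optCondRisk ℓ η ≤ condRisk ℓ η α := ciInf_le (bddBelow_condRisk hnonneg hη) α

lemma optCondRisk_nonneg (hnonneg : ∀ t y, 0 ≤ ℓ t y) {η : ℝ} (hη : η ∈ Icc (0 : ℝ) 1) :
    0 ≤ optCondRisk ℓ η := le_ciInf fun α => condRisk_nonneg hnonneg hη α

lemma optWrongCondRisk_le (hnonneg : ∀ t y, 0 ≤ ℓ t y) {η : ℝ} (hη : η ∈ Icc (0 : ℝ) 1) {α : ℝ}
    (hα : α * (η - 1 / 2) ≤ 0) : optWrongCondRisk ℓ η ≤ condRisk ℓ η α :=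
  ciInf_le (f := fun α : {α : ℝ // α * (η - 1 / 2) ≤ 0} => condRisk ℓ η α)
    ⟨0, by rintro _ ⟨α, rfl⟩; exact condRisk_nonneg hnonneg hη α⟩ ⟨α, hα⟩

lemma nonempty_wrong (η : ℝ) : Nonempty {α : ℝ // α * (η - 1 / 2) ≤ 0} := ⟨⟨0, by simp⟩⟩

/-- The conditional risks at nearby class probabilities are comparable. -/
lemma exists_condRisk_ratio (hnonneg : ∀ t y, 0 ≤ ℓ t y) {η₀ : ℝ} (hη₀ : η₀ ∈ Icc (0 : ℝ) 1) :
    ∃ r : ℝ → ℝ, Continuous r ∧ r η₀ = 1 ∧ ∀ η ∈ Icc (0 : ℝ) 1, 0 ≤ r η ∧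
      ∀ α, r η * condRisk ℓ η₀ α ≤ condRisk ℓ η α := by
  -- The loss may be unbounded, so an additive comparison uniform in `α` is not available. The
  -- multiplicative factor is the smaller of `η / η₀` and `(1 - η) / (1 - η₀)`, a quotient with zero
  -- denominator being replaced by `1`.
  have key : ∀ p₀ : ℝ, 0 ≤ p₀ → ∃ r : ℝ → ℝ, Continuous r ∧ r p₀ = 1 ∧
      ∀ p, 0 ≤ p → 0 ≤ r p ∧ r p * p₀ ≤ p := by
    intro p₀ hp₀
    rcases hp₀.eq_or_lt with h | h
    · exact ⟨fun _ => 1, continuous_const, rfl, fun p hp => ⟨zero_le_one, by simpa [← h] using hp⟩⟩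
    · exact ⟨fun p => p / p₀, by fun_prop, div_self h.ne', fun p hp =>
        ⟨div_nonneg hp hp₀, (div_mul_cancel₀ p h.ne').le⟩⟩
  obtain ⟨r₁, hc₁, h₁, hr₁⟩ := key η₀ hη₀.1
  obtain ⟨r₂, hc₂, h₂, hr₂⟩ := key (1 - η₀) (sub_nonneg.2 hη₀.2)
  refine ⟨fun η => min (r₁ η) (r₂ (1 - η)), hc₁.min (hc₂.comp (by fun_prop)), by simp [h₁, h₂],
    fun η hη => ?_⟩
  obtain ⟨h1, h1'⟩ := hr₁ η hη.1
  obtain ⟨h2, h2'⟩ := hr₂ (1 - η) (sub_nonneg.2 hη.2)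
  refine ⟨le_min h1 h2, fun α => ?_⟩
  have e1 : min (r₁ η) (r₂ (1 - η)) * η₀ ≤ η :=
    (mul_le_mul_of_nonneg_right (min_le_left _ _) hη₀.1).trans h1'
  have e2 : min (r₁ η) (r₂ (1 - η)) * (1 - η₀) ≤ 1 - η :=
    (mul_le_mul_of_nonneg_right (min_le_right _ _) (sub_nonneg.2 hη₀.2)).trans h2'
  have := mul_le_mul_of_nonneg_right e1 (hnonneg α 1)
  have := mul_le_mul_of_nonneg_right e2 (hnonneg α (-1))
  simp only [condRisk]
  linarith

/-- The optimal risk is an infimum of functions affine in `η`, hence upper semicontinuous. The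
wrong-side optimum is lower semicontinuous away from `1/2`: nearby `η` have the same wrong side, and
their conditional risks are bounded below, uniformly in `α`, by those at `η₀` times a factor tending
to `1`. -/
lemma lowerSemicontinuousOn_gap (hnonneg : ∀ t y, 0 ≤ ℓ t y) {K : Set ℝ}
    (hK : K ⊆ Icc 0 1) (hhalf : 1 / 2 ∉ K) :
    LowerSemicontinuousOn (fun η => optWrongCondRisk ℓ η - optCondRisk ℓ η) K := by
  intro η₀ hη₀K y hy
  have hη₀ := hK hη₀K
  have hne : η₀ - 1 / 2 ≠ 0 := fun h => hhalf (by rwa [← sub_eq_zero.1 h])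
  set e := (optWrongCondRisk ℓ η₀ - optCondRisk ℓ η₀ - y) / 2 with he
  have hepos : 0 < e := by simp only at hy; linarith
  obtain ⟨r, hrc, hr1, hr⟩ := exists_condRisk_ratio hnonneg hη₀
  obtain ⟨α, hα⟩ := exists_lt_of_ciInf_lt
    (show (⨅ α, condRisk ℓ η₀ α) < optCondRisk ℓ η₀ + e from lt_add_of_pos_right _ hepos)
  have ev1 : ∀ᶠ η in nhds η₀, condRisk ℓ η α < optCondRisk ℓ η₀ + e :=
    (show Continuous fun η => condRisk ℓ η α by unfold condRisk; fun_prop).continuousAt.eventually_lt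
      continuousAt_const hα
  have ev2 : ∀ᶠ η in nhds η₀, optWrongCondRisk ℓ η₀ - e < r η * optWrongCondRisk ℓ η₀ :=
    continuousAt_const.eventually_lt (hrc.mul continuous_const).continuousAt (by rw [hr1]; linarith)
  have ev3 : ∀ᶠ η in nhds η₀, 0 < (η - 1 / 2) * (η₀ - 1 / 2) :=
    continuousAt_const.eventually_lt
      (show Continuous fun η : ℝ => (η - 1 / 2) * (η₀ - 1 / 2) by fun_prop).continuousAt
      (mul_self_pos.2 hne)
  filter_upwards [self_mem_nhdsWithin, nhdsWithin_le_nhds ev1, nhdsWithin_le_nhds ev2,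
    nhdsWithin_le_nhds ev3] with η hηK h1 h2 h3
  have hη := hK hηK
  have hO := optCondRisk_le hnonneg hη α
  have hW : r η * optWrongCondRisk ℓ η₀ ≤ optWrongCondRisk ℓ η := by
    have := nonempty_wrong η
    refine le_ciInf fun β => ?_
    -- `η` and `η₀` lie on the same side of `1/2`, so an output that is wrong for `η` is wrong for
    -- `η₀`.
    have hβ : (β : ℝ) * (η₀ - 1 / 2) ≤ 0 := by
      have hsq : 0 < (η - 1 / 2) ^ 2 := by
        have : η - 1 / 2 ≠ 0 := fun h => by rw [h] at h3; simp at h3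
        positivity
      have := mul_nonpos_of_nonpos_of_nonneg β.2 h3.le
      by_contra hcon
      push Not at hcon
      nlinarith
    exact (mul_le_mul_of_nonneg_left (optWrongCondRisk_le hnonneg hη₀ hβ) (hr η hη).1).trans
      ((hr η hη).2 β)
  linarith

/-- A lower semicontinuous function attains its minimum on a compact set, and calibration makes this
minimum positive. -/
lemma exists_gap_lower_bound (hnonneg : ∀ t y, 0 ≤ ℓ t y) (hcal : ClassificationCalibrated ℓ)
    {θ₀ : ℝ} (hθ₀ : 0 < θ₀) :
    ∃ m > 0, ∀ η ∈ Icc (0 : ℝ) 1, θ₀ ≤ |2 * η - 1| →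
      m ≤ optWrongCondRisk ℓ η - optCondRisk ℓ η := by
  set K : Set ℝ := Icc 0 1 ∩ {η | θ₀ ≤ |2 * η - 1|} with hKdef
  have hKc : IsCompact K := isCompact_Icc.inter_right (isClosed_le continuous_const (by fun_prop))
  have hhalf : (1 / 2 : ℝ) ∉ K := fun h => by
    have := h.2
    norm_num at this
    linarith
  rcases K.eq_empty_or_nonempty with h | h
  -- The compact set is empty exactly when `θ₀ > 1`; any positive constant then serves.
  · exact ⟨1, one_pos, fun η hη hθ => absurd (show η ∈ K from ⟨hη, hθ⟩) (by simp [h])⟩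
  · obtain ⟨η₀, hη₀, hmin⟩ := (lowerSemicontinuousOn_gap hnonneg
      (inter_subset_left : K ⊆ Icc 0 1) hhalf).exists_isMinOn h hKc
    exact ⟨_, sub_pos.2 (hcal η₀ hη₀.1 fun h => hhalf (h ▸ hη₀)),
      fun η hη hθ => hmin (show η ∈ K from ⟨hη, hθ⟩)⟩

/-- The calibration function of a classification-calibrated loss. -/
lemma exists_calibration_function (hnonneg : ∀ t y, 0 ≤ ℓ t y)
    (hcal : ClassificationCalibrated ℓ) :
    ∃ ψ : ℝ → ℝ, ConvexOn ℝ (Ici 0) ψ ∧ StrictMonoOn ψ (Ici 0) ∧ ContinuousOn ψ (Ici 0) ∧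
      BijOn ψ (Ici 0) (Ici 0) ∧ ψ 0 = 0 ∧ ∀ η ∈ Icc (0 : ℝ) 1, η ≠ 1 / 2 →
        ψ |2 * η - 1| ≤ optWrongCondRisk ℓ η - optCondRisk ℓ η := by
  obtain ⟨ψ, h1, h2, h3, h4, h5, h6⟩ := exists_convex_minorant
    (ι := {η : ℝ // η ∈ Icc (0 : ℝ) 1 ∧ η ≠ 1 / 2}) (fun η => |2 * (η : ℝ) - 1|)
    (fun η => optWrongCondRisk ℓ η - optCondRisk ℓ η)
    (fun η => ⟨abs_nonneg _, abs_le.2 ⟨by linarith [η.2.1.1], by linarith [η.2.1.2]⟩⟩)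
    (fun η => (sub_pos.2 (hcal η η.2.1 η.2.2)).le)
    (fun θ₀ hθ₀ => by
      obtain ⟨m, hm, hm'⟩ := exists_gap_lower_bound hnonneg hcal hθ₀.1
      exact ⟨m, hm, fun η => hm' η η.2.1⟩)
  exact ⟨ψ, h1, h2, h3, h4, h5, fun η hη hne => h6 ⟨η, hη, hne⟩⟩

end Gap

/-! ### The posterior class probability -/

section Posterior

variable {X : Type*} [MeasurableSpace X] {P : Measure (X × ℤˣ)}

/-- The law of `x` on the event that the label is `y` (not normalized). -/
def labelLaw (P : Measure (X × ℤˣ)) (y : ℤˣ) : Measure X :=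
  (P.restrict (Prod.snd ⁻¹' {y})).map Prod.fst

lemma measurableSet_label (y : ℤˣ) : MeasurableSet (Prod.snd ⁻¹' {y} : Set (X × ℤˣ)) :=
  measurable_snd (MeasurableSet.singleton y)

lemma compl_label {X : Type*} : (Prod.snd ⁻¹' {1} : Set (X × ℤˣ))ᶜ = Prod.snd ⁻¹' {-1} := by
  ext ⟨x, y⟩
  rcases Int.units_eq_one_or y with rfl | rfl <;> simp

instance [IsFiniteMeasure P] (y : ℤˣ) : IsFiniteMeasure (labelLaw P y) := by
  unfold labelLaw; infer_instance

instance [IsProbabilityMeasure P] : IsProbabilityMeasure (marginal P) :=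
  Measure.isProbabilityMeasure_map measurable_fst.aemeasurable

lemma lintegral_eq_labelLaw {f : X → ℤˣ → ℝ≥0∞} (hf : ∀ y, Measurable fun x => f x y) :
    ∫⁻ z, f z.1 z.2 ∂P = ∫⁻ x, f x 1 ∂(labelLaw P 1) + ∫⁻ x, f x (-1) ∂(labelLaw P (-1)) := by
  have key : ∀ y, ∫⁻ x, f x y ∂(labelLaw P y) = ∫⁻ z in Prod.snd ⁻¹' {y}, f z.1 z.2 ∂P := by
    intro y
    rw [labelLaw, lintegral_map (hf y) measurable_fst]
    refine setLIntegral_congr_fun (measurableSet_label y) fun z hz => ?_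
    rw [show z.2 = y from hz]
  rw [key, key, ← lintegral_add_compl _ (measurableSet_label 1), compl_label]

lemma marginal_eq_labelLaw : marginal P = labelLaw P 1 + labelLaw P (-1) := by
  rw [marginal, labelLaw, labelLaw, ← Measure.map_add _ _ measurable_fst, ← compl_label,
    Measure.restrict_add_restrict_compl (measurableSet_label 1)]

/-- `η x` is the conditional probability of the label `1` given `x`. -/
def IsPosterior (P : Measure (X × ℤˣ)) (η : X → ℝ) : Prop :=
  ∀ f : X → ℤˣ → ℝ≥0∞, (∀ y, Measurable fun x => f x y) →
    ∫⁻ z, f z.1 z.2 ∂P = ∫⁻ x, ENNReal.ofReal (η x) * f x 1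
      + ENNReal.ofReal (1 - η x) * f x (-1) ∂(marginal P)

/-- `η` is the density of the positive part of the law with respect to the marginal. It is cut at
`1` so that the bounds hold everywhere; since the part is dominated by the whole, this changes it on
a null set only. The negative part follows by subtraction. -/
lemma exists_posterior (P : Measure (X × ℤˣ)) [IsProbabilityMeasure P] :
    ∃ η : X → ℝ, Measurable η ∧ (∀ x, η x ∈ Icc (0 : ℝ) 1) ∧ IsPosterior P η := by
  have hle : labelLaw P 1 ≤ marginal P := by
    rw [marginal_eq_labelLaw]; exact Measure.le_add_right le_rfl
  set ρ := (labelLaw P 1).rnDeriv (marginal P) with hρ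
  have hρm : Measurable ρ := Measure.measurable_rnDeriv _ _
  set η : X → ℝ := fun x => (min (ρ x) 1).toReal with hη
  have hηm : Measurable η := (hρm.min measurable_const).ennreal_toReal
  have hη01 : ∀ x, η x ∈ Icc (0 : ℝ) 1 := fun x =>
    ⟨ENNReal.toReal_nonneg, ENNReal.toReal_mono ENNReal.one_ne_top (min_le_right _ _)⟩
  have h1 : (marginal P).withDensity (fun x => ENNReal.ofReal (η x)) = labelLaw P 1 := by
    rw [← Measure.withDensity_rnDeriv_eq _ _ (Measure.absolutelyContinuous_of_le hle)]
    refine withDensity_congr_ae ?_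
    filter_upwards [Measure.rnDeriv_le_one_of_le hle] with x hx
    rw [hη]
    simp only
    rw [min_eq_left (show ρ x ≤ 1 from hx), ENNReal.ofReal_toReal (ne_top_of_le_ne_top ENNReal.one_ne_top hx)]
  have h2 : (marginal P).withDensity (fun x => ENNReal.ofReal (1 - η x)) = labelLaw P (-1) := by
    rw [← Measure.add_right_inj (labelLaw P 1), ← marginal_eq_labelLaw, ← h1,
      ← withDensity_add_left (by fun_prop)]
    convert withDensity_one (μ := marginal P) using 2
    ext x
    simp only [Pi.add_apply, Pi.one_apply]
    rw [← ENNReal.ofReal_add (hη01 x).1 (sub_nonneg.2 (hη01 x).2), add_sub_cancel,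
      ENNReal.ofReal_one]
  refine ⟨η, hηm, hη01, fun f hf => ?_⟩
  rw [lintegral_eq_labelLaw hf, ← h1, ← h2,
    lintegral_withDensity_eq_lintegral_mul _ (by fun_prop) (hf 1),
    lintegral_withDensity_eq_lintegral_mul _ (by fun_prop) (hf (-1)),
    ← lintegral_add_left ((by fun_prop : Measurable fun x => ENNReal.ofReal (η x)).mul (hf 1))]
  rfl

lemma risk_eq_lintegral_condRisk {η : X → ℝ} (hη01 : ∀ x, η x ∈ Icc (0 : ℝ) 1)
    (hη : IsPosterior P η)
    {ℓ : Loss} (hmeas : ∀ y, Measurable fun t => ℓ t y) (hnonneg : ∀ t y, 0 ≤ ℓ t y)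
    {g : X → ℝ} (hg : Measurable g) :
    risk P ℓ g = ∫⁻ x, ENNReal.ofReal (condRisk ℓ (η x) (g x)) ∂(marginal P) := by
  rw [risk, hη (fun x y => ENNReal.ofReal (ℓ (g x) y)) fun y => ((hmeas y).comp hg).ennreal_ofReal]
  refine lintegral_congr fun x => ?_
  rw [condRisk, ENNReal.ofReal_add (mul_nonneg (hη01 x).1 (hnonneg _ _))
    (mul_nonneg (sub_nonneg.2 (hη01 x).2) (hnonneg _ _)), ENNReal.ofReal_mul (hη01 x).1,
    ENNReal.ofReal_mul (sub_nonneg.2 (hη01 x).2)]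

/-! ### The optimal risk is attained pointwise -/

/-- The loss need not be continuous in its output. But the conditional risk is a continuous function
of the pair `(ℓ t 1, ℓ t (-1))`, and the set of these pairs in the plane is separable; a dense
sequence in it serves all `η` simultaneously. -/
lemma exists_seq_condRisk_lt (ℓ : Loss) : ∃ α : ℕ → ℝ, ∀ η : ℝ, ∀ b, optCondRisk ℓ η < b →
    ∃ k, condRisk ℓ η (α k) < b := by
  set φ : ℝ → ℝ × ℝ := fun t => (ℓ t 1, ℓ t (-1)) with hφ
  have hne : Nonempty (range φ) := ⟨⟨φ 0, mem_range_self 0⟩⟩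
  have hdense := TopologicalSpace.denseRange_denseSeq (range φ)
  choose α hα using fun k => (TopologicalSpace.denseSeq (range φ) k).2
  refine ⟨α, fun η b hb => ?_⟩
  obtain ⟨t, ht⟩ := exists_lt_of_ciInf_lt hb
  have hopen : IsOpen {q : range φ | η * q.1.1 + (1 - η) * q.1.2 < b} :=
    isOpen_lt (by fun_prop) continuous_const
  obtain ⟨k, hk⟩ := hdense.exists_mem_open hopen ⟨⟨φ t, mem_range_self t⟩, ht⟩
  refine ⟨k, ?_⟩
  have : η * (φ (α k)).1 + (1 - η) * (φ (α k)).2 < b := by rw [hα]; exact hk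
  exact this

/-- With countably many candidate outputs, the optimal conditional risk is measurable in `x`, and
choosing the first candidate within `ε` of it is a measurable selection. -/
lemma bayesRisk_le_lintegral {η : X → ℝ} (hηm : Measurable η) (hη01 : ∀ x, η x ∈ Icc (0 : ℝ) 1)
    [IsProbabilityMeasure P]
    (hη : IsPosterior P η)
    {ℓ : Loss} (hmeas : ∀ y, Measurable fun t => ℓ t y) (hnonneg : ∀ t y, 0 ≤ ℓ t y) :
    bayesRisk P ℓ ≤ ∫⁻ x, ENNReal.ofReal (optCondRisk ℓ (η x)) ∂(marginal P) := by
  classical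
  obtain ⟨α, hα⟩ := exists_seq_condRisk_lt ℓ
  have hcm : ∀ k, Measurable fun x => condRisk ℓ (η x) (α k) := fun k => by
    unfold condRisk; fun_prop
  have hopt : ∀ x, optCondRisk ℓ (η x) = ⨅ k, condRisk ℓ (η x) (α k) := fun x => by
    refine le_antisymm (le_ciInf fun k => optCondRisk_le hnonneg (hη01 x) _) ?_
    refine le_of_forall_gt_imp_ge_of_dense fun b hb => ?_
    obtain ⟨k, hk⟩ := hα (η x) b hb
    exact (ciInf_le ⟨0, by rintro _ ⟨k, rfl⟩; exact condRisk_nonneg hnonneg (hη01 x) _⟩ k).trans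
      hk.le
  have hoptm : Measurable fun x => optCondRisk ℓ (η x) := by
    simp only [hopt]; exact Measurable.iInf hcm
  refine ENNReal.le_of_forall_pos_le_add fun ε hε _ => ?_
  have hex : ∀ x, ∃ k, condRisk ℓ (η x) (α k) < optCondRisk ℓ (η x) + ε := fun x =>
    hα _ _ (lt_add_of_pos_right _ hε)
  set g : X → ℝ := fun x => α (Nat.find (hex x)) with hg
  have hgm : Measurable g := (measurable_from_nat (f := α)).comp
    (measurable_find hex fun k => measurableSet_lt (hcm k) (hoptm.add_const _))
  calc bayesRisk P ℓ ≤ risk P ℓ g := iInf₂_le g hgm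
    _ = ∫⁻ x, ENNReal.ofReal (condRisk ℓ (η x) (g x)) ∂(marginal P) :=
        risk_eq_lintegral_condRisk hη01 hη hmeas hnonneg hgm
    _ ≤ ∫⁻ x, ENNReal.ofReal (optCondRisk ℓ (η x)) + ε ∂(marginal P) := by
        refine lintegral_mono fun x => ?_
        refine (ENNReal.ofReal_le_ofReal (Nat.find_spec (hex x)).le).trans ?_
        rw [ENNReal.ofReal_add (optCondRisk_nonneg hnonneg (hη01 x)) ε.coe_nonneg,
          ENNReal.ofReal_coe_nnreal]
    _ = ∫⁻ x, ENNReal.ofReal (optCondRisk ℓ (η x)) ∂(marginal P) + ε := by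
        rw [lintegral_add_right _ measurable_const]; simp

/-! ### From excess risk to excess zero-one risk -/

open Classical in
/-- The conditional excess zero-one risk `|2η - 1|` of the outputs `α` on the wrong side. -/
def wrongMargin (η α : ℝ) : ℝ := if α * (η - 1 / 2) ≤ 0 then |2 * η - 1| else 0

lemma wrongMargin_mem {η : ℝ} (hη : η ∈ Icc (0 : ℝ) 1) (α : ℝ) :
    wrongMargin η α ∈ Icc (0 : ℝ) 1 := by
  have : |2 * η - 1| ≤ 1 := abs_le.2 ⟨by linarith [hη.1], by linarith [hη.2]⟩
  unfold wrongMargin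
  split_ifs
  · exact ⟨abs_nonneg _, this⟩
  · simp

lemma measurable_wrongMargin {η g : X → ℝ} (hη : Measurable η) (hg : Measurable g) :
    Measurable fun x => wrongMargin (η x) (g x) :=
  Measurable.ite (measurableSet_le (hg.mul (hη.sub_const _)) measurable_const)
    (by fun_prop) measurable_const

lemma zeroOneLossTie_nonneg (s : ℤˣ) (t : ℝ) (y : ℤˣ) : 0 ≤ zeroOneLossTie s t y := by
  unfold zeroOneLossTie; split_ifs <;> simp

lemma zeroOneLoss_nonneg (t : ℝ) (y : ℤˣ) : 0 ≤ zeroOneLoss t y := by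
  unfold zeroOneLoss; split_ifs <;> simp

lemma measurable_zeroOneLoss (y : ℤˣ) : Measurable fun t => zeroOneLoss t y :=
  Measurable.ite (measurableSet_lt measurable_const (by fun_prop)) measurable_const measurable_const

lemma measurable_zeroOneLossTie (s y : ℤˣ) : Measurable fun t => zeroOneLossTie s t y :=
  Measurable.ite ((measurableSet_lt (f := fun _ => (0 : ℝ)) (g := fun t : ℝ => t * ((y : ℤ) : ℝ))
    measurable_const (by fun_prop)).union ((MeasurableSet.singleton (0 : ℝ)).inter
      (MeasurableSet.const (y = s)))) measurable_const measurable_const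

/-- The conditional zero-one risk takes only the values `η` and `1 - η`, which differ by `|2η - 1|`.
The output `0` counts as wrong in `wrongMargin` for every `η`, which covers both tie conventions. -/
lemma condRisk_zeroOneLossTie_le (s : ℤˣ) {η : ℝ} (hη : η ∈ Icc (0 : ℝ) 1) (α β : ℝ) :
    condRisk (zeroOneLossTie s) η α ≤ condRisk (zeroOneLossTie s) η β + wrongMargin η α := by
  obtain ⟨h0, h1⟩ := hη
  have key : ∀ γ : ℝ, (condRisk (zeroOneLossTie s) η γ = η ∧ γ ≤ 0) ∨
      (condRisk (zeroOneLossTie s) η γ = 1 - η ∧ 0 ≤ γ) := by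
    intro γ
    rcases Int.units_eq_one_or s with rfl | rfl <;> rcases lt_trichotomy γ 0 with h | rfl | h
    all_goals first
      | simp [condRisk, zeroOneLossTie]; done
      | simp [condRisk, zeroOneLossTie, h, h.le, h.ne, h.ne', h.not_gt]
  unfold wrongMargin
  have hb := key β
  have habs := le_abs_self (2 * η - 1)
  have habs' := neg_abs_le (2 * η - 1)
  have habs0 := abs_nonneg (2 * η - 1)
  rcases key α with ⟨ha, ha'⟩ | ⟨ha, ha'⟩ <;> rcases hb with ⟨hb, -⟩ | ⟨hb, -⟩ <;> rw [ha, hb] <;>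
    split_ifs with hc <;> (try linarith) <;> push Not at hc
  · by_contra hcon
    push Not at hcon
    nlinarith
  · by_contra hcon
    push Not at hcon
    nlinarith

lemma condRisk_zeroOneLoss_eq (s : ℤˣ) {α : ℝ} (hα : α ≠ 0) (η : ℝ) :
    condRisk zeroOneLoss η α = condRisk (zeroOneLossTie s) η α := by
  simp [condRisk, zeroOneLoss, zeroOneLossTie, hα]

lemma condRisk_zeroOneLossTie_le_zeroOneLoss (s : ℤˣ) {η : ℝ} (hη : η ∈ Icc (0 : ℝ) 1) (α : ℝ) :
    condRisk (zeroOneLossTie s) η α ≤ condRisk zeroOneLoss η α := by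
  have : ∀ y, zeroOneLossTie s α y ≤ zeroOneLoss α y := fun y => by
    unfold zeroOneLossTie zeroOneLoss
    split_ifs <;> simp_all
  unfold condRisk
  have h1 := hη.1
  have h2 := sub_nonneg.2 hη.2
  gcongr <;> exact this _

/-- The pointwise comparison is integrated against an arbitrary competitor. It is assumed only
almost everywhere because for `zeroOneLoss` it can fail where `g` vanishes. -/
lemma excessRisk_le_integral_wrongMargin [IsProbabilityMeasure P] {η : X → ℝ} (hηm : Measurable η)
    (hη01 : ∀ x, η x ∈ Icc (0 : ℝ) 1)
    (hη : IsPosterior P η)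
    {ℓ : Loss} (hmeas : ∀ y, Measurable fun t => ℓ t y) (hnonneg : ∀ t y, 0 ≤ ℓ t y)
    {g : X → ℝ} (hg : Measurable g) (hfin : bayesRisk P ℓ ≠ ∞)
    (hle : ∀ᵐ x ∂(marginal P), ∀ β, condRisk ℓ (η x) (g x) ≤
      condRisk ℓ (η x) β + wrongMargin (η x) (g x)) :
    excessRisk P ℓ g ≤ ∫ x, wrongMargin (η x) (g x) ∂(marginal P) := by
  have hTm := measurable_wrongMargin hηm hg
  have hT0 : ∀ x, 0 ≤ wrongMargin (η x) (g x) := fun x => (wrongMargin_mem (hη01 x) _).1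
  have hTint : Integrable (fun x => wrongMargin (η x) (g x)) (marginal P) :=
    Integrable.of_bound hTm.aestronglyMeasurable 1 (ae_of_all _ fun x => by
      rw [Real.norm_eq_abs, abs_of_nonneg (hT0 x)]; exact (wrongMargin_mem (hη01 x) _).2)
  have h : risk P ℓ g ≤
      bayesRisk P ℓ + ENNReal.ofReal (∫ x, wrongMargin (η x) (g x) ∂(marginal P)) := by
    rw [bayesRisk]
    simp only [ENNReal.iInf_add]
    refine le_iInf₂ fun g' hg' => ?_
    rw [risk_eq_lintegral_condRisk hη01 hη hmeas hnonneg hg,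
      risk_eq_lintegral_condRisk hη01 hη hmeas hnonneg hg',
      ofReal_integral_eq_lintegral_ofReal hTint (ae_of_all _ hT0),
      ← lintegral_add_right _ hTm.ennreal_ofReal]
    refine lintegral_mono_ae (hle.mono fun x hx => ?_)
    rw [← ENNReal.ofReal_add (condRisk_nonneg hnonneg (hη01 x) _) (hT0 x)]
    exact ENNReal.ofReal_le_ofReal (hx _)
  have h' := ENNReal.toReal_mono (ENNReal.add_ne_top.2 ⟨hfin, ENNReal.ofReal_ne_top⟩) h
  rw [ENNReal.toReal_add hfin ENNReal.ofReal_ne_top,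
    ENNReal.toReal_ofReal (integral_nonneg hT0)] at h'
  rw [excessRisk]
  linarith

lemma risk_ne_top [IsProbabilityMeasure P] {ℓ : Loss} {g : X → ℝ} {C : ℝ}
    (hC : ∀ x y, ℓ (g x) y ≤ C) : risk P ℓ g ≠ ∞ := by
  refine ((lintegral_mono fun z : X × ℤˣ => ENNReal.ofReal_le_ofReal (hC z.1 z.2)).trans_lt ?_).ne
  simp

lemma bayesRisk_ne_top [IsProbabilityMeasure P] (ℓ : Loss) : bayesRisk P ℓ ≠ ∞ := by
  refine ne_top_of_le_ne_top (risk_ne_top (C := max (ℓ 0 1) (ℓ 0 (-1))) ?_)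
    (iInf₂_le (fun _ : X => (0 : ℝ)) measurable_const)
  intro x y
  rcases Int.units_eq_one_or y with rfl | rfl
  · exact le_max_left _ _
  · exact le_max_right _ _

/-- Jensen's inequality moves `ψ` inside the integral, where the calibration gap bounds it by the
pointwise excess conditional risk. -/
lemma map_integral_wrongMargin_le [IsProbabilityMeasure P] {η : X → ℝ} (hηm : Measurable η)
    (hη01 : ∀ x, η x ∈ Icc (0 : ℝ) 1)
    (hη : IsPosterior P η)
    {ℓ : Loss} (hmeas : ∀ y, Measurable fun t => ℓ t y) (hnonneg : ∀ t y, 0 ≤ ℓ t y)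
    {ψ : ℝ → ℝ} (hconv : ConvexOn ℝ (Ici 0) ψ) (hmono : MonotoneOn ψ (Ici 0))
    (hcont : ContinuousOn ψ (Ici 0)) (hψ0 : ψ 0 = 0)
    (hψ : ∀ η ∈ Icc (0 : ℝ) 1, η ≠ 1 / 2 →
        ψ |2 * η - 1| ≤ optWrongCondRisk ℓ η - optCondRisk ℓ η)
    {g : X → ℝ} (hg : Measurable g) (hfin : risk P ℓ g ≠ ∞) :
    ψ (∫ x, wrongMargin (η x) (g x) ∂(marginal P)) ≤ excessRisk P ℓ g := by
  have hTm := measurable_wrongMargin hηm hg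
  have hT := fun x => wrongMargin_mem (hη01 x) (g x)
  set T : X → ℝ := fun x => wrongMargin (η x) (g x) with hTdef
  have hTint : Integrable T (marginal P) :=
    Integrable.of_bound hTm.aestronglyMeasurable 1 (ae_of_all _ fun x => by
      rw [Real.norm_eq_abs, abs_of_nonneg (hT x).1]; exact (hT x).2)
  have hψT0 : ∀ x, 0 ≤ ψ (T x) := fun x =>
    hψ0 ▸ hmono (mem_Ici.2 le_rfl) (mem_Ici.2 (hT x).1) (hT x).1
  have hψT1 : ∀ x, ψ (T x) ≤ ψ 1 := fun x =>
    hmono (mem_Ici.2 (hT x).1) (mem_Ici.2 zero_le_one) (hT x).2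
  have hψTm : Measurable fun x => ψ (T x) := by
    -- `ψ` is controlled only on the half-line; composing with `max 0` gives a globally continuous
    -- function that agrees with it at the values of `T`.
    have hc : Continuous fun t => ψ (max 0 t) :=
      hcont.comp_continuous (by fun_prop) fun t => mem_Ici.2 (le_max_left _ _)
    have := hc.measurable.comp hTm
    have hmax : ∀ x, max 0 (T x) = T x := fun x => max_eq_right (hT x).1
    simpa only [Function.comp_def, hmax] using this
  have hψTint : Integrable (fun x => ψ (T x)) (marginal P) :=
    Integrable.of_bound hψTm.aestronglyMeasurable (ψ 1) (ae_of_all _ fun x => by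
      rw [Real.norm_eq_abs, abs_of_nonneg (hψT0 x)]; exact hψT1 x)
  refine (hconv.map_integral_le hcont isClosed_Ici (ae_of_all _ fun x => (hT x).1) hTint
    hψTint).trans ?_
  -- If `T x ≠ 0`, then `g x` is on the wrong side and `η x ≠ 1/2`, so the gap applies. Otherwise `ψ
  -- 0 = 0` and optimality suffices.
  have hpt : ∀ x, ψ (T x) + optCondRisk ℓ (η x) ≤ condRisk ℓ (η x) (g x) := by
    intro x
    have hO := optCondRisk_le hnonneg (hη01 x) (g x)
    rcases eq_or_ne (T x) 0 with h0 | h0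
    · rw [h0, hψ0, zero_add]; exact hO
    · simp only [hTdef, wrongMargin] at h0 ⊢
      split_ifs at h0 ⊢ with hc
      · have hne : η x ≠ 1 / 2 := fun h => h0 (by rw [h]; norm_num)
        have := hψ _ (hη01 x) hne
        have := optWrongCondRisk_le hnonneg (hη01 x) hc
        linarith
      · exact absurd rfl h0
  have h : ENNReal.ofReal (∫ x, ψ (T x) ∂(marginal P)) + bayesRisk P ℓ ≤ risk P ℓ g := by
    calc _ ≤ ∫⁻ x, ENNReal.ofReal (ψ (T x)) ∂(marginal P)
          + ∫⁻ x, ENNReal.ofReal (optCondRisk ℓ (η x)) ∂(marginal P) := by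
          rw [ofReal_integral_eq_lintegral_ofReal hψTint (ae_of_all _ hψT0)]
          gcongr
          exact bayesRisk_le_lintegral hηm hη01 hη hmeas hnonneg
      _ ≤ risk P ℓ g := by
          rw [← lintegral_add_left hψTm.ennreal_ofReal,
            risk_eq_lintegral_condRisk hη01 hη hmeas hnonneg hg]
          refine lintegral_mono fun x => ?_
          rw [← ENNReal.ofReal_add (hψT0 x) (optCondRisk_nonneg hnonneg (hη01 x))]
          exact ENNReal.ofReal_le_ofReal (hpt x)
  have h' := ENNReal.toReal_mono hfin h
  rw [ENNReal.toReal_add ENNReal.ofReal_ne_top (bayesRisk_ne_top ℓ),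
    ENNReal.toReal_ofReal (integral_nonneg hψT0)] at h'
  rw [excessRisk]
  linarith

/-- The calibration inequality: a bound on the excess risk yields one on the excess zero-one
risk. -/
lemma excessZeroOneRiskLE_of_excessRisk_le [IsProbabilityMeasure P]
    {ℓ : Loss} (hmeas : ∀ y, Measurable fun t => ℓ t y) (hnonneg : ∀ t y, 0 ≤ ℓ t y)
    {ψ : ℝ → ℝ} (hconv : ConvexOn ℝ (Ici 0) ψ) (hmono : StrictMonoOn ψ (Ici 0))
    (hcont : ContinuousOn ψ (Ici 0)) (hbij : BijOn ψ (Ici 0) (Ici 0)) (hψ0 : ψ 0 = 0)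
    (hψ : ∀ η ∈ Icc (0 : ℝ) 1, η ≠ 1 / 2 →
        ψ |2 * η - 1| ≤ optWrongCondRisk ℓ η - optCondRisk ℓ η)
    {g : X → ℝ} (hg : Measurable g) (hfin : risk P ℓ g ≠ ∞) {b : ℝ}
    (hb : excessRisk P ℓ g ≤ b) :
    ExcessZeroOneRiskLE P g (Function.invFunOn ψ (Ici 0) b) := by
  obtain ⟨η, hηm, hη01, hη⟩ := exists_posterior P
  have hT0 : 0 ≤ ∫ x, wrongMargin (η x) (g x) ∂(marginal P) :=
    integral_nonneg fun x => (wrongMargin_mem (hη01 x) _).1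
  have hψT := (map_integral_wrongMargin_le hηm hη01 hη hmeas hnonneg hconv hmono.monotoneOn hcont
    hψ0 hψ hg hfin).trans hb
  -- Nonnegativity of `b` puts it in the range of `ψ`, so that `Function.invFunOn` is a genuine
  -- inverse there and not a default value.
  have hb0 : 0 ≤ b := (hbij.mapsTo (mem_Ici.2 hT0)).out.trans hψT
  have hTle : ∫ x, wrongMargin (η x) (g x) ∂(marginal P) ≤ Function.invFunOn ψ (Ici 0) b := by
    obtain ⟨t, ht, htb⟩ := hbij.surjOn (mem_Ici.2 hb0)
    have hex : ∃ a ∈ Ici (0 : ℝ), ψ a = b := ⟨t, ht, htb⟩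
    rw [← hmono.le_iff_le (mem_Ici.2 hT0) (Function.invFunOn_mem hex), Function.invFunOn_eq hex]
    exact hψT
  refine ⟨fun s => le_trans (excessRisk_le_integral_wrongMargin hηm hη01 hη
    (measurable_zeroOneLossTie s) (zeroOneLossTie_nonneg s) hg (bayesRisk_ne_top _)
    (ae_of_all _ fun x β => condRisk_zeroOneLossTie_le s (hη01 x) _ _)) hTle, fun hne => ?_⟩
  refine le_trans (excessRisk_le_integral_wrongMargin hηm hη01 hη
    measurable_zeroOneLoss zeroOneLoss_nonneg hg (bayesRisk_ne_top _)
    (hne.mono fun x hx β => ?_)) hTle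
  -- At a nonzero output the two zero-one losses agree; at the competitor `β`, which may be `0`, the
  -- loss with ties is the smaller one. The tie label `1` is arbitrary.
  rw [condRisk_zeroOneLoss_eq 1 hx]
  exact (condRisk_zeroOneLossTie_le 1 (hη01 x) _ β).trans
    (add_le_add (condRisk_zeroOneLossTie_le_zeroOneLoss 1 (hη01 x) β) le_rfl)

end Posterior

/-! ### Contraction -/

section Contraction

variable {G : Type*} [Nonempty G]

omit [Nonempty G] in
lemma bddAbove_range_of_abs_le {f : G → ℝ} {M : ℝ} (h : ∀ g, |f g| ≤ M) : BddAbove (range f) :=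
  ⟨M, by rintro _ ⟨g, rfl⟩; exact (abs_le.1 (h g)).2⟩

lemma abs_ciSup_le_of_abs_le {f : G → ℝ} {M : ℝ} (h : ∀ g, |f g| ≤ M) : |⨆ g, f g| ≤ M := by
  obtain ⟨g⟩ := ‹Nonempty G›
  exact abs_le.2 ⟨(abs_le.1 (h g)).1.trans (le_ciSup (bddAbove_range_of_abs_le h) g),
    have : Nonempty G := ⟨g⟩; ciSup_le fun g => (abs_le.1 (h g)).2⟩

/-- For a pair `g, g'` the two `φ` terms differ by at most `L * |u g - u g'|`. According to the sign
of `u g - u g'`, this is a competitor on the right with `g, g'` in this order or interchanged. -/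
lemma iSup_add_iSup_contraction {a u : G → ℝ} {M C L : ℝ} {φ : ℝ → ℝ} (ha : ∀ g, |a g| ≤ M)
    (hu : ∀ g, |u g| ≤ C) (hφ : ∀ s t, |φ s - φ t| ≤ L * |s - t|) :
    (⨆ g, (a g + φ (u g))) + (⨆ g, (a g - φ (u g))) ≤
      (⨆ g, (a g + L * u g)) + ⨆ g, (a g - L * u g) := by
  have hLu : ∀ g, |L * u g| ≤ |L| * C := fun g => by
    rw [abs_mul]; gcongr; exact hu g
  have hb1 : BddAbove (range fun g => a g + L * u g) :=
    bddAbove_range_of_abs_le fun g => (abs_add_le _ _).trans (add_le_add (ha g) (hLu g))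
  have hb2 : BddAbove (range fun g => a g - L * u g) :=
    bddAbove_range_of_abs_le fun g => (abs_sub _ _).trans (add_le_add (ha g) (hLu g))
  rw [← le_sub_iff_add_le]
  refine ciSup_le fun g => ?_
  rw [le_sub_comm]
  refine ciSup_le fun g' => ?_
  have h := (le_abs_self _).trans (hφ (u g) (u g'))
  have h1 := le_ciSup hb1 g
  have h2 := le_ciSup hb2 g'
  have h3 := le_ciSup hb1 g'
  have h4 := le_ciSup hb2 g
  rcases abs_cases (u g - u g') with ⟨h5, -⟩ | ⟨h5, -⟩ <;> rw [h5] at h <;> linarith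

lemma abs_unit_mul (s : ℤˣ) (t : ℝ) : |((s : ℤ) : ℝ) * t| = |t| := by
  rcases Int.units_eq_one_or s with rfl | rfl <;> simp

lemma abs_sum_unit_mul_le {n : ℕ} (σ : Fin n → ℤˣ) {f : Fin n → ℝ} {B : ℝ}
    (hf : ∀ i, |f i| ≤ B) : |∑ i, ((σ i : ℤ) : ℝ) * f i| ≤ n * B := by
  refine (Finset.abs_sum_le_sum_abs _ _).trans ?_
  simp only [abs_unit_mul]
  exact (Finset.sum_le_sum fun i _ => hf i).trans (by simp)

lemma sum_signs_succ {n : ℕ} (F : (Fin (n + 1) → ℤˣ) → ℝ) :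
    ∑ σ, F σ = ∑ σ : Fin n → ℤˣ, (F (Fin.cons 1 σ) + F (Fin.cons (-1) σ)) := by
  rw [← (Fin.consEquiv fun _ : Fin (n + 1) => ℤˣ).sum_comp F, Fintype.sum_prod_type_right]
  refine Finset.sum_congr rfl fun σ _ => ?_
  rw [UnitsInt.univ, Finset.sum_pair (by decide)]
  rfl

/-- The contraction principle for Rademacher averages (without absolute values). -/
lemma sum_iSup_contraction {n : ℕ} {φ : ℝ → ℝ} {L B C : ℝ}
    (hφ : ∀ s t, |φ s - φ t| ≤ L * |s - t|) (hB : ∀ t, |φ t| ≤ B) {a : G → ℝ} {M : ℝ}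
    (ha : ∀ g, |a g| ≤ M) {u : Fin n → G → ℝ} (hu : ∀ i g, |u i g| ≤ C) :
    ∑ σ : Fin n → ℤˣ, ⨆ g, (a g + ∑ i, ((σ i : ℤ) : ℝ) * φ (u i g)) ≤
      ∑ σ : Fin n → ℤˣ, ⨆ g, (a g + ∑ i, ((σ i : ℤ) : ℝ) * (L * u i g)) := by
  induction n generalizing a M with
  | zero => simp
  | succ n ih =>
    rw [sum_signs_succ, sum_signs_succ]
    simp only [Fin.sum_univ_succ, Fin.cons_zero, Fin.cons_succ, Units.val_one, Int.cast_one,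
      one_mul, Units.val_neg, Int.cast_neg, neg_mul, ← add_assoc, ← sub_eq_add_neg]
    have hLu : ∀ i g, |L * u i g| ≤ |L| * C := fun i g => by
      rw [abs_mul]; gcongr; exact hu i g
    -- Coordinate `0` is contracted with the other signs fixed; the resulting term `± L * u 0 g` is
    -- then absorbed into `a`, which is why the induction generalizes over `a`.
    calc ∑ σ : Fin n → ℤˣ, ((⨆ g, (a g + φ (u 0 g) + ∑ i, ((σ i : ℤ) : ℝ) * φ (u i.succ g)))
          + ⨆ g, (a g - φ (u 0 g) + ∑ i, ((σ i : ℤ) : ℝ) * φ (u i.succ g)))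
        ≤ ∑ σ : Fin n → ℤˣ, ((⨆ g, (a g + L * u 0 g + ∑ i, ((σ i : ℤ) : ℝ) * φ (u i.succ g)))
          + ⨆ g, (a g - L * u 0 g + ∑ i, ((σ i : ℤ) : ℝ) * φ (u i.succ g))) := by
          refine Finset.sum_le_sum fun σ _ => ?_
          have := iSup_add_iSup_contraction
            (a := fun g => a g + ∑ i, ((σ i : ℤ) : ℝ) * φ (u i.succ g)) (u := u 0)
            (fun g => (abs_add_le _ _).trans (add_le_add (ha g)
              (abs_sum_unit_mul_le σ fun i => hB _))) (hu 0) hφ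
          simpa only [add_right_comm, add_sub_right_comm] using this
      _ ≤ _ := by
          rw [Finset.sum_add_distrib, Finset.sum_add_distrib]
          exact add_le_add
            (ih (fun g => (abs_add_le _ _).trans (add_le_add (ha g) (hLu 0 g)))
              fun i g => hu i.succ g)
            (ih (fun g => (abs_sub _ _).trans (add_le_add (ha g) (hLu 0 g)))
              fun i g => hu i.succ g)

end Contraction

/-! ### Symmetrization -/

section Symmetrization

variable {X : Type*} [MeasurableSpace X] {𝒢 : Set (X → ℝ)}

lemma MeasurableSuprema.univMeas (h : MeasurableSuprema 𝒢) {ι Ω : Type*} [Fintype ι]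
    [MeasurableSpace Ω] {F : (ι → ℝ) → ℝ} (hF : Continuous F) {z : Ω → ι → X}
    (hz : ∀ i, Measurable fun ω => z ω i) :
    UnivMeas fun ω => ⨆ g : 𝒢, F fun i => g.1 (z ω i) := by
  set e := (Fintype.equivFin ι).symm
  have h1 : UnivMeas fun w : Fin (Fintype.card ι) → X =>
      ⨆ g : 𝒢, F fun i => g.1 (w (e.symm i)) := fun ν _ =>
    h _ (fun v => F fun i => v (e.symm i)) (hF.comp (by fun_prop)) ν
  have h2 := h1.comp (g := fun ω i => z ω (e i)) (measurable_pi_iff.2 fun i => hz (e i))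
  simpa only [Equiv.apply_symm_apply] using h2

/-- Exchange of the `i`-th points of two samples for those `i` with `σ i ≠ 1`. -/
def exchange {n : ℕ} (σ : Fin n → ℤˣ) (w : (Fin n → X) × (Fin n → X)) :
    (Fin n → X) × (Fin n → X) :=
  (fun i => if σ i = 1 then w.1 i else w.2 i, fun i => if σ i = 1 then w.2 i else w.1 i)

/-- Seen as a sample of pairs, the exchange acts on each pair by the identity or by the swap, and
both preserve `q.prod q`. -/
lemma measurePreserving_exchange {n : ℕ} (σ : Fin n → ℤˣ) (q : Measure X)
    [IsProbabilityMeasure q] :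
    MeasurePreserving (exchange σ) ((Measure.pi fun _ : Fin n => q).prod (Measure.pi fun _ => q))
      ((Measure.pi fun _ : Fin n => q).prod (Measure.pi fun _ => q)) := by
  have hE := measurePreserving_arrowProdEquivProdArrow X X (Fin n) (fun _ => q) (fun _ => q)
  have hswap : ∀ i, MeasurePreserving (fun x : X × X => if σ i = 1 then x else x.swap)
      (q.prod q) (q.prod q) := fun i => by
    by_cases h : σ i = 1
    · simp only [h, if_true]; exact MeasurePreserving.id _
    · simpa only [h, if_false] using Measure.measurePreserving_swap
  have h := (hE.comp (measurePreserving_pi _ _ hswap)).comp hE.symm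
  convert h using 1
  ext w i
  · simp only [exchange, Function.comp, MeasurableEquiv.arrowProdEquivProdArrow]
    by_cases h : σ i = 1 <;> simp [h, Equiv.arrowProdEquivProdArrow]
  · simp only [exchange, Function.comp, MeasurableEquiv.arrowProdEquivProdArrow]
    by_cases h : σ i = 1 <;> simp [h, Equiv.arrowProdEquivProdArrow]

lemma abs_mean_le {n : ℕ} {f : Fin n → ℝ} {B : ℝ} (hB : 0 ≤ B) (hf : ∀ i, |f i| ≤ B) :
    |(1 / (n : ℝ)) * ∑ i, f i| ≤ B := by
  rw [abs_mul, abs_of_nonneg (by positivity : (0 : ℝ) ≤ 1 / n)]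
  calc 1 / (n : ℝ) * |∑ i, f i| ≤ 1 / (n : ℝ) * (n * B) := by
        gcongr
        exact (Finset.abs_sum_le_sum_abs _ _).trans
          ((Finset.sum_le_sum fun i _ => hf i).trans (by simp))
    _ = (1 / (n : ℝ) * n) * B := by ring
    _ ≤ 1 * B := by
        gcongr
        rcases eq_or_ne (n : ℝ) 0 with h | h
        · simp [h]
        · rw [one_div_mul_cancel h]
    _ = B := one_mul _

lemma univMeas_signedSup (h : MeasurableSuprema 𝒢) {φ : ℝ → ℝ} (hφ : Continuous φ) {n : ℕ}
    (σ : Fin n → ℤˣ) : UnivMeas fun z : Fin n → X =>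
      ⨆ g : 𝒢, (1 / (n : ℝ)) * ∑ i, ((σ i : ℤ) : ℝ) * φ (g.1 (z i)) :=
  h.univMeas (F := fun v => (1 / (n : ℝ)) * ∑ i, ((σ i : ℤ) : ℝ) * φ (v i)) (by fun_prop)
    (z := fun z => z) fun i => measurable_pi_apply i

/-- Any fixed member of the class bounds the supremum from below, and its signed means cancel under
`σ ↦ -σ`. -/
lemma rademacher_nonneg {Cg : ℝ} (hCg : ∀ g ∈ 𝒢, ∀ x, |g x| ≤ Cg)
    (hne : 𝒢.Nonempty) (n : ℕ) (q : Measure X) : 0 ≤ rademacher n q 𝒢 := by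
  obtain ⟨g₀, hg₀⟩ := hne
  refine integral_nonneg fun z => mul_nonneg (by positivity) ?_
  calc (0 : ℝ) = ∑ σ : Fin n → ℤˣ, (1 / (n : ℝ)) * ∑ i, ((σ i : ℤ) : ℝ) * g₀ (z i) := by
        have h0 := Fintype.sum_equiv (Equiv.neg (Fin n → ℤˣ)) _
          (fun σ : Fin n → ℤˣ => (1 / (n : ℝ)) * ∑ i, ((σ i : ℤ) : ℝ) * g₀ (z i)) fun σ => rfl
        simp only [Equiv.neg_apply, Pi.neg_apply, Units.val_neg, Int.cast_neg, neg_mul,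
          Finset.sum_neg_distrib, mul_neg] at h0
        linarith
    _ ≤ _ := by
        refine Finset.sum_le_sum fun σ _ => ?_
        refine le_ciSup (f := fun g : 𝒢 => (1 / (n : ℝ)) * ∑ i, ((σ i : ℤ) : ℝ) * g.1 (z i))
          (bddAbove_range_of_abs_le (M := max Cg 0) fun g => ?_) ⟨g₀, hg₀⟩
        exact abs_mean_le (le_max_right _ _) fun i => by
          rw [abs_unit_mul]; exact (hCg _ g.2 _).trans (le_max_left _ _)

omit [MeasurableSpace X] in
lemma sum_signedSup_le {Cg : ℝ} (hCg : ∀ g ∈ 𝒢, ∀ x, |g x| ≤ Cg) (hne : 𝒢.Nonempty) {φ : ℝ → ℝ}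
    {L B : ℝ} (hL : 0 ≤ L) (hφ : ∀ s t, |φ s - φ t| ≤ L * |s - t|) (hB : ∀ t, |φ t| ≤ B) {n : ℕ}
    (z : Fin n → X) :
    ∑ σ : Fin n → ℤˣ, ⨆ g : 𝒢, (1 / (n : ℝ)) * ∑ i, ((σ i : ℤ) : ℝ) * φ (g.1 (z i)) ≤
      L * ∑ σ : Fin n → ℤˣ, ⨆ g : 𝒢, (1 / (n : ℝ)) * ∑ i, ((σ i : ℤ) : ℝ) * g.1 (z i) := by
  have := hne.to_subtype
  have hn : (0 : ℝ) ≤ 1 / n := by positivity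
  have h := sum_iSup_contraction (G := 𝒢) (n := n) (φ := fun t => 1 / (n : ℝ) * φ t)
    (L := 1 / (n : ℝ) * L) (B := 1 / (n : ℝ) * B) (a := fun _ => 0) (M := 0)
    (u := fun i g => g.1 (z i)) (C := Cg)
    (fun s t => by
      rw [← mul_sub, abs_mul, abs_of_nonneg hn, mul_assoc]; gcongr; exact hφ s t)
    (fun t => by rw [abs_mul, abs_of_nonneg hn]; gcongr; exact hB t) (by simp)
    (fun i g => hCg _ g.2 _)
  simp only [zero_add] at h
  rw [Finset.mul_sum]
  simp only [Real.mul_iSup_of_nonneg hL]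
  convert h using 5 with σ _ g σ _ g
  · rw [Finset.mul_sum]; exact Finset.sum_congr rfl fun i _ => by ring
  · rw [Finset.mul_sum, Finset.mul_sum]; exact Finset.sum_congr rfl fun i _ => by ring

/-- The expected supremum of the difference of two empirical means is at most twice the Rademacher
complexity. -/
lemma integral_iSup_mean_sub_mean_le (h : MeasurableSuprema 𝒢) {Cg : ℝ}
    (hCg : ∀ g ∈ 𝒢, ∀ x, |g x| ≤ Cg) (hne : 𝒢.Nonempty) {φ : ℝ → ℝ} (hφc : Continuous φ)
    {L B : ℝ} (hL : 0 ≤ L) (hφ : ∀ s t, |φ s - φ t| ≤ L * |s - t|) (hB : ∀ t, |φ t| ≤ B)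
    (n : ℕ) (q : Measure X) [IsProbabilityMeasure q] :
    ∫ w : (Fin n → X) × (Fin n → X),
        ⨆ g : 𝒢, ((1 / (n : ℝ)) * ∑ i, φ (g.1 (w.2 i)) - (1 / (n : ℝ)) * ∑ i, φ (g.1 (w.1 i)))
        ∂((Measure.pi fun _ : Fin n => q).prod (Measure.pi fun _ : Fin n => q)) ≤
      2 * L * rademacher n q 𝒢 := by
  have hne' := hne.to_subtype
  have hB0 : 0 ≤ B := (abs_nonneg _).trans (hB 0)
  set Q := Measure.pi fun _ : Fin n => q
  set H : (Fin n → X) × (Fin n → X) → ℝ := fun w =>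
    ⨆ g : 𝒢, ((1 / (n : ℝ)) * ∑ i, φ (g.1 (w.2 i)) - (1 / (n : ℝ)) * ∑ i, φ (g.1 (w.1 i))) with hH
  set R : (Fin n → ℤˣ) → (Fin n → X) → ℝ := fun σ z =>
    ⨆ g : 𝒢, (1 / (n : ℝ)) * ∑ i, ((σ i : ℤ) : ℝ) * φ (g.1 (z i)) with hR
  have hterm : ∀ (σ : Fin n → ℤˣ) (z : Fin n → X) (g : 𝒢),
      |(1 / (n : ℝ)) * ∑ i, ((σ i : ℤ) : ℝ) * φ (g.1 (z i))| ≤ B := fun σ z g =>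
    abs_mean_le hB0 fun i => by rw [abs_unit_mul]; exact hB _
  have hRm : ∀ σ, UnivMeas (R σ) := univMeas_signedSup h hφc
  have hRB : ∀ σ z, |R σ z| ≤ B := fun σ z => abs_ciSup_le_of_abs_le (hterm σ z)
  have hHm : UnivMeas H := by
    have := h.univMeas (ι := Fin n ⊕ Fin n) (F := fun v => (1 / (n : ℝ)) * ∑ i, φ (v (.inr i))
        - (1 / (n : ℝ)) * ∑ i, φ (v (.inl i))) (by fun_prop)
      (z := fun w : (Fin n → X) × (Fin n → X) => Sum.elim w.1 w.2) (by
        rintro (i | i)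
        · exact (measurable_pi_apply i).comp measurable_fst
        · exact (measurable_pi_apply i).comp measurable_snd)
    exact this
  have hHB : ∀ w, |H w| ≤ B + B := fun w => abs_ciSup_le_of_abs_le fun g =>
    (abs_sub _ _).trans (add_le_add (abs_mean_le hB0 fun i => hB _)
      (abs_mean_le hB0 fun i => hB _))
  -- Exchanging points multiplies the `i`-th difference by `σ i`; the supremum of the signed
  -- difference splits into one signed supremum per sample.
  have hle : ∀ σ w, H (exchange σ w) ≤ R σ w.2 + R (-σ) w.1 := by
    intro σ w
    refine ciSup_le fun g => ?_
    have h1 : (1 / (n : ℝ)) * ∑ i, φ (g.1 ((exchange σ w).2 i))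
        - (1 / (n : ℝ)) * ∑ i, φ (g.1 ((exchange σ w).1 i)) =
        (1 / (n : ℝ)) * ∑ i, ((σ i : ℤ) : ℝ) * φ (g.1 (w.2 i))
        + (1 / (n : ℝ)) * ∑ i, (((-σ) i : ℤ) : ℝ) * φ (g.1 (w.1 i)) := by
      rw [← mul_sub, ← mul_add, ← Finset.sum_sub_distrib, ← Finset.sum_add_distrib]
      congr 1
      refine Finset.sum_congr rfl fun i _ => ?_
      rcases Int.units_eq_one_or (σ i) with hi | hi <;> simp [exchange, hi] <;> ring
    rw [h1]
    exact add_le_add (le_ciSup (bddAbove_range_of_abs_le (hterm σ w.2)) g)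
      (le_ciSup (bddAbove_range_of_abs_le (hterm (-σ) w.1)) g)
  have hσ : ∀ σ, ∫ w, H w ∂(Q.prod Q) ≤ ∫ z, R σ z ∂Q + ∫ z, R (-σ) z ∂Q := by
    intro σ
    have hmp := measurePreserving_exchange σ q
    have e1 : ∫ w, H w ∂(Q.prod Q) = ∫ w, H (exchange σ w) ∂(Q.prod Q) := by
      have := integral_map hmp.measurable.aemeasurable
        (by rw [hmp.map_eq]; exact (hHm _).aestronglyMeasurable : AEStronglyMeasurable H _)
      rwa [hmp.map_eq] at this
    have e2 : ∫ w, R σ w.2 ∂(Q.prod Q) = ∫ z, R σ z ∂Q := by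
      rw [integral_fun_snd]; simp
    have e3 : ∫ w, R (-σ) w.1 ∂(Q.prod Q) = ∫ z, R (-σ) z ∂Q := by
      rw [integral_fun_fst]; simp
    have i2 := ((hRm σ).comp (measurable_snd (α := Fin n → X))).integrable
      (fun w => hRB σ w.2) (Q.prod Q)
    have i3 := ((hRm (-σ)).comp (measurable_fst (β := Fin n → X))).integrable
      (fun w => hRB (-σ) w.1) (Q.prod Q)
    rw [e1, ← e2, ← e3, ← integral_add i2 i3]
    exact integral_mono ((hHm.comp hmp.measurable).integrable (fun w => hHB _) _) (i2.add i3)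
      (hle σ)
  -- Summation over all sign vectors identifies the contributions of `σ` and `-σ`, which produces
  -- the factor `2`.
  have hsum : (2 : ℝ) ^ n * ∫ w, H w ∂(Q.prod Q) ≤ 2 * ∑ σ, ∫ z, R σ z ∂Q := by
    have h1 := Finset.sum_le_sum fun σ (_ : σ ∈ Finset.univ) => hσ σ
    rw [Finset.sum_add_distrib, Fintype.sum_equiv (Equiv.neg (Fin n → ℤˣ))
      (fun σ => ∫ z, R (-σ) z ∂Q) (fun σ => ∫ z, R σ z ∂Q) fun σ => rfl] at h1
    simp only [Finset.sum_const, Finset.card_univ, Fintype.card_pi, Fintype.card_units_int,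
      Finset.prod_const, Fintype.card_fin, nsmul_eq_mul, Nat.cast_pow, Nat.cast_ofNat] at h1
    linarith
  have hrad : ∑ σ, ∫ z, R σ z ∂Q ≤ 2 ^ n * (L * rademacher n q 𝒢) := by
    rw [← integral_finsetSum _ fun σ _ => (hRm σ).integrable (hRB σ) Q]
    have h1 : (2 : ℝ) ^ n * (L * rademacher n q 𝒢) = ∫ z, L * ∑ σ : Fin n → ℤˣ,
        ⨆ g : 𝒢, (1 / (n : ℝ)) * ∑ i, ((σ i : ℤ) : ℝ) * g.1 (z i) ∂Q := by
      rw [rademacher, integral_const_mul, integral_const_mul]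
      field_simp
      rfl
    rw [h1]
    refine integral_mono (integrable_finsetSum _ fun σ _ => (hRm σ).integrable (hRB σ) Q) ?_
      fun z => sum_signedSup_le hCg hne hL hφ hB z
    refine Integrable.const_mul (integrable_finsetSum _ fun σ _ => ?_) _
    refine (univMeas_signedSup h (φ := fun t => t) continuous_id σ).integrable (M := max Cg 0)
      (fun z => abs_ciSup_le_of_abs_le fun g => abs_mean_le (le_max_right _ _) fun i => ?_) Q
    rw [abs_unit_mul]; exact (hCg _ g.2 _).trans (le_max_left _ _)
  have h2 : (0 : ℝ) < 2 ^ n := by positivity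
  have h3 : (2 : ℝ) ^ n * ∫ w, H w ∂(Q.prod Q) ≤ 2 ^ n * (2 * L * rademacher n q 𝒢) := by linarith
  exact le_of_mul_le_mul_left h3 h2

end Symmetrization

section Estimation

variable {X : Type*} [MeasurableSpace X] {P : Measure (X × ℤˣ)}

/-! ### The law of the samples -/

lemma isProbabilityMeasure_classLaw [IsProbabilityMeasure P] {y : ℤˣ} (hy : 0 < prior P y) :
    IsProbabilityMeasure (classLaw P y) := by
  have : IsProbabilityMeasure (ProbabilityTheory.cond P (Prod.snd ⁻¹' {y})) :=
    cond_isProbabilityMeasure fun h => by simp [prior, Measure.real, h] at hy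
  exact Measure.isProbabilityMeasure_map measurable_fst.aemeasurable

lemma labelLaw_eq_smul [IsProbabilityMeasure P] {y : ℤˣ} (hy : 0 < prior P y) :
    labelLaw P y = ENNReal.ofReal (prior P y) • classLaw P y := by
  have h0 : P (Prod.snd ⁻¹' {y}) ≠ 0 := fun h => by simp [prior, Measure.real, h] at hy
  rw [classLaw, ProbabilityTheory.cond, Measure.map_smul, smul_smul, prior,
    ofReal_measureReal, ENNReal.mul_inv_cancel h0 (measure_ne_top _ _), one_smul, labelLaw]

lemma integral_labelLaw [IsProbabilityMeasure P] {y : ℤˣ} (hy : 0 < prior P y) (f : X → ℝ) :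
    ∫ x, f x ∂(labelLaw P y) = prior P y * ∫ x, f x ∂(classLaw P y) := by
  rw [labelLaw_eq_smul hy, integral_smul_measure, ENNReal.toReal_ofReal hy.le, smul_eq_mul]

lemma integrable_of_mem_Icc_zero {Ω : Type*} [MeasurableSpace Ω] {μ : Measure Ω}
    [IsFiniteMeasure μ] {f : Ω → ℝ} (hf : Measurable f) {C : ℝ} (hC : ∀ x, f x ∈ Icc 0 C) :
    Integrable f μ :=
  Integrable.of_mem_Icc 0 C hf.aemeasurable (ae_of_all _ hC)

lemma partialRisk_marginal [IsProbabilityMeasure P] (hπ : ∀ y, 0 < prior P y) {ℓ : Loss}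
    (hmeas : ∀ y, Measurable fun t => ℓ t y) {C : ℝ} (hC : ∀ t y, ℓ t y ∈ Icc 0 C) (y : ℤˣ)
    {g : X → ℝ} (hg : Measurable g) :
    partialRisk (marginal P) ℓ y g = prior P 1 * partialRisk (classLaw P 1) ℓ y g
      + prior P (-1) * partialRisk (classLaw P (-1)) ℓ y g := by
  have hm : Measurable fun x => ℓ (g x) y := (hmeas y).comp hg
  rw [partialRisk, marginal_eq_labelLaw, integral_add_measure
    (integrable_of_mem_Icc_zero hm fun x => hC _ _) (integrable_of_mem_Icc_zero hm fun x => hC _ _),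
    integral_labelLaw (hπ 1), integral_labelLaw (hπ (-1)), partialRisk, partialRisk]

lemma toReal_risk [IsProbabilityMeasure P] (hπ : ∀ y, 0 < prior P y) {ℓ : Loss}
    (hmeas : ∀ y, Measurable fun t => ℓ t y) {C : ℝ} (hC : ∀ t y, ℓ t y ∈ Icc 0 C)
    {g : X → ℝ} (hg : Measurable g) :
    (risk P ℓ g).toReal = prior P 1 * partialRisk (classLaw P 1) ℓ 1 g
      + prior P (-1) * partialRisk (classLaw P (-1)) ℓ (-1) g := by
  have hm : ∀ y, Measurable fun x => ℓ (g x) y := fun y => (hmeas y).comp hg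
  have key : ∀ y, ∫⁻ x, ENNReal.ofReal (ℓ (g x) y) ∂(labelLaw P y) =
      ENNReal.ofReal (prior P y * partialRisk (classLaw P y) ℓ y g) := fun y => by
    rw [← ofReal_integral_eq_lintegral_ofReal (integrable_of_mem_Icc_zero (hm y) fun x => hC _ _)
      (ae_of_all _ fun x => (hC _ _).1), integral_labelLaw (hπ y), partialRisk]
  have h0 : ∀ y, 0 ≤ prior P y * partialRisk (classLaw P y) ℓ y g := fun y =>
    mul_nonneg (hπ y).le (integral_nonneg fun x => (hC _ _).1)
  rw [risk, lintegral_eq_labelLaw (f := fun x y => ENNReal.ofReal (ℓ (g x) y))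
    fun y => (hm y).ennreal_ofReal, key, key, ← ENNReal.ofReal_add (h0 _) (h0 _),
    ENNReal.toReal_ofReal (add_nonneg (h0 _) (h0 _))]

lemma isProbabilityMeasure_sampleLaw [IsProbabilityMeasure P] (hπ : ∀ y, 0 < prior P y)
    (np nn nu : ℕ) : IsProbabilityMeasure (sampleLaw P np nn nu) := by
  have := fun y => isProbabilityMeasure_classLaw (hπ y)
  unfold sampleLaw; infer_instance

variable {np nn nu : ℕ}

lemma measurePreserving_positive [IsProbabilityMeasure P] (hπ : ∀ y, 0 < prior P y) :
    MeasurePreserving (fun S : Samples X np nn nu => S.1) (sampleLaw P np nn nu)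
      (Measure.pi fun _ => classLaw P 1) := by
  have := fun y => isProbabilityMeasure_classLaw (hπ y)
  exact measurePreserving_fst

lemma measurePreserving_negative [IsProbabilityMeasure P] (hπ : ∀ y, 0 < prior P y) :
    MeasurePreserving (fun S : Samples X np nn nu => S.2.1) (sampleLaw P np nn nu)
      (Measure.pi fun _ => classLaw P (-1)) := by
  have := fun y => isProbabilityMeasure_classLaw (hπ y)
  exact measurePreserving_fst.comp measurePreserving_snd

lemma measurePreserving_unlabeled [IsProbabilityMeasure P] (hπ : ∀ y, 0 < prior P y) :
    MeasurePreserving (fun S : Samples X np nn nu => S.2.2) (sampleLaw P np nn nu)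
      (Measure.pi fun _ => marginal P) := by
  have := fun y => isProbabilityMeasure_classLaw (hπ y)
  exact measurePreserving_snd.comp measurePreserving_snd

/-- The weighted Hamming distance of two triples of samples. -/
def sampleDist (cp cn cu : ℝ) (S T : Samples X np nn nu) : ℝ :=
  weightedHamming cp S.1 T.1 + (weightedHamming cn S.2.1 T.2.1 + weightedHamming cu S.2.2 T.2.2)

lemma concentrates_sampleLaw [IsProbabilityMeasure P] (hπ : ∀ y, 0 < prior P y) {cp cn cu : ℝ}
    (hp : 0 ≤ cp) (hn : 0 ≤ cn) (hu : 0 ≤ cu) :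
    Concentrates (sampleLaw P np nn nu) (sampleDist cp cn cu)
      (np * cp ^ 2 / 4 + (nn * cn ^ 2 / 4 + nu * cu ^ 2 / 4)) := by
  have := fun y => isProbabilityMeasure_classLaw (hπ y)
  exact (concentrates_pi _ hp _).prod ((concentrates_pi _ hn _).prod (concentrates_pi _ hu _)
    (weightedHamming_self _) (weightedHamming_self _)) (weightedHamming_self _)
    fun S => by simp [weightedHamming_self]

/-! ### Empirical means -/

omit [MeasurableSpace X] in
lemma weightedHamming_comm {n : ℕ} (c : ℝ) (x y : Fin n → X) :
    weightedHamming c x y = weightedHamming c y x := by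
  classical
  exact Finset.sum_congr rfl fun i _ => if_congr eq_comm rfl rfl

omit [MeasurableSpace X] in
lemma weightedHamming_mul {n : ℕ} (k c : ℝ) (x y : Fin n → X) :
    weightedHamming (k * c) x y = k * weightedHamming c x y := by
  classical
  simp [weightedHamming, Finset.mul_sum, mul_ite]

variable {ℓ : Loss} {C : ℝ}

omit [MeasurableSpace X] in
lemma abs_empMean_sub_le (hC : ∀ t y, ℓ t y ∈ Icc 0 C) (y : ℤˣ) {n : ℕ} (x x' : Fin n → X)
    (g : X → ℝ) :
    |empMean ℓ y x g - empMean ℓ y x' g| ≤ weightedHamming (C / n) x x' := by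
  classical
  rw [empMean, empMean, ← mul_sub, ← Finset.sum_sub_distrib, abs_mul,
    abs_of_nonneg (by positivity : (0 : ℝ) ≤ 1 / n), show C / n = 1 / n * C by ring,
    weightedHamming_mul]
  gcongr
  refine (Finset.abs_sum_le_sum_abs _ _).trans (Finset.sum_le_sum fun i _ => ?_)
  split_ifs with h
  · simp [h]
  · have h1 := hC (g (x i)) y
    have h2 := hC (g (x' i)) y
    exact abs_le.2 ⟨by linarith [h1.1, h2.2], by linarith [h1.2, h2.1]⟩

omit [MeasurableSpace X] in
lemma empMean_mem (hC : ∀ t y, ℓ t y ∈ Icc 0 C) (y : ℤˣ) {n : ℕ} (x : Fin n → X) (g : X → ℝ) :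
    empMean ℓ y x g ∈ Icc 0 C := by
  refine ⟨mul_nonneg (by positivity) (Finset.sum_nonneg fun i _ => (hC _ _).1), ?_⟩
  exact (le_abs_self _).trans (abs_mean_le ((hC 0 1).1.trans (hC 0 1).2) fun i => by
    rw [abs_of_nonneg (hC _ _).1]; exact (hC _ _).2)

lemma measurable_empMean (hmeas : ∀ y, Measurable fun t => ℓ t y) (y : ℤˣ) {n : ℕ} {g : X → ℝ}
    (hg : Measurable g) : Measurable fun x : Fin n → X => empMean ℓ y x g :=
  (Finset.measurable_sum _ fun i _ =>
    ((hmeas y).comp hg).comp (measurable_pi_apply i)).const_mul _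

lemma integral_empMean (hmeas : ∀ y, Measurable fun t => ℓ t y) (hC : ∀ t y, ℓ t y ∈ Icc 0 C)
    (y : ℤˣ) {n : ℕ} (hn : 0 < n) (q : Measure X) [IsProbabilityMeasure q] {g : X → ℝ}
    (hg : Measurable g) :
    ∫ x, empMean ℓ y x g ∂(Measure.pi fun _ : Fin n => q) = partialRisk q ℓ y g := by
  have hm : Measurable fun x => ℓ (g x) y := (hmeas y).comp hg
  unfold empMean
  rw [integral_const_mul, integral_finsetSum _ fun i _ =>
    integrable_of_mem_Icc_zero (f := fun x : Fin n → X => ℓ (g (x i)) y)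
      (hm.comp (measurable_pi_apply i)) fun x => hC _ _]
  have h : ∀ i : Fin n, ∫ x : Fin n → X, ℓ (g (x i)) y ∂(Measure.pi fun _ => q) =
      partialRisk q ℓ y g := fun i =>
    integral_comp_eval (μ := fun _ : Fin n => q) (f := fun x => ℓ (g x) y)
      hm.aestronglyMeasurable
  simp only [h, Finset.sum_const, Finset.card_univ, Fintype.card_fin, nsmul_eq_mul]
  field_simp

lemma integrable_empMean_comp (hmeas : ∀ y, Measurable fun t => ℓ t y)
    (hC : ∀ t y, ℓ t y ∈ Icc 0 C) (y : ℤˣ) {n : ℕ} {g : X → ℝ} (hg : Measurable g) {Ω : Type*}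
    [MeasurableSpace Ω] {μ : Measure Ω} [IsFiniteMeasure μ] {z : Ω → Fin n → X}
    (hz : Measurable z) : Integrable (fun ω => empMean ℓ y (z ω) g) μ :=
  integrable_of_mem_Icc_zero ((measurable_empMean hmeas y hg).comp hz) fun _ => empMean_mem hC _ _ _

lemma integral_empMean_comp (hmeas : ∀ y, Measurable fun t => ℓ t y)
    (hC : ∀ t y, ℓ t y ∈ Icc 0 C) (y : ℤˣ) {n : ℕ} (hn : 0 < n) {q : Measure X}
    [IsProbabilityMeasure q] {g : X → ℝ} (hg : Measurable g) {Ω : Type*} [MeasurableSpace Ω]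
    {μ : Measure Ω} {z : Ω → Fin n → X} (hz : MeasurePreserving z μ (Measure.pi fun _ => q)) :
    ∫ ω, empMean ℓ y (z ω) g ∂μ = partialRisk q ℓ y g := by
  rw [← integral_empMean hmeas hC y hn q hg, ← hz.map_eq, integral_map hz.measurable.aemeasurable
    (measurable_empMean hmeas y hg).aestronglyMeasurable]

/-! ### Empirical risks -/

variable {a : ℝ}

lemma measurable_empRisk1 (hmeas : ∀ y, Measurable fun t => ℓ t y) {g : X → ℝ}
    (hg : Measurable g) : Measurable fun S : Samples X np nn nu => empRisk1 P ℓ a S g := by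
  have h := fun y (n : ℕ) => measurable_empMean (n := n) hmeas y hg
  have h1 := (h 1 np).comp (measurable_fst : Measurable fun S : Samples X np nn nu => S.1)
  have h2 := fun y => (h y nn).comp
    (measurable_fst.comp measurable_snd : Measurable fun S : Samples X np nn nu => S.2.1)
  have h3 := (h 1 nu).comp
    (measurable_snd.comp measurable_snd : Measurable fun S : Samples X np nn nu => S.2.2)
  exact (((h2 (-1)).const_mul _).add (h1.const_mul _)).add
    ((measurable_const.max (h3.sub ((h2 1).const_mul _))).const_mul _)

lemma measurable_empRisk2 (hmeas : ∀ y, Measurable fun t => ℓ t y) {g : X → ℝ}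
    (hg : Measurable g) : Measurable fun S : Samples X np nn nu => empRisk2 P ℓ a S g := by
  have h := fun y (n : ℕ) => measurable_empMean (n := n) hmeas y hg
  have h1 := (h 1 np).comp (measurable_fst : Measurable fun S : Samples X np nn nu => S.1)
  have h2 := fun y => (h y nn).comp
    (measurable_fst.comp measurable_snd : Measurable fun S : Samples X np nn nu => S.2.1)
  have h3 := (h 1 nu).comp
    (measurable_snd.comp measurable_snd : Measurable fun S : Samples X np nn nu => S.2.2)
  exact (((h3.const_mul _).add (h1.const_mul _)).add ((h2 (-1)).const_mul _)).sub
    ((h2 1).const_mul _)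

/-- Since `max 0 A = A + max 0 (-A)`, clipping adds a nonnegative correction to the unbiased
estimator. This correction carries the whole bias. -/
lemma empRisk1_eq (S : Samples X np nn nu) (g : X → ℝ) :
    empRisk1 P ℓ a S g = empRisk2 P ℓ a S g
      + a * max 0 (prior P (-1) * empMean ℓ 1 S.2.1 g - empMean ℓ 1 S.2.2 g) := by
  unfold empRisk1 empRisk2
  rcases le_total 0 (empMean ℓ 1 S.2.2 g - prior P (-1) * empMean ℓ 1 S.2.1 g) with h | h
  · rw [max_eq_right h, max_eq_left (by linarith)]; ring
  · rw [max_eq_left h, max_eq_right (by linarith)]; ring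

lemma empRisk2_le_empRisk1 (ha : 0 ≤ a) (S : Samples X np nn nu) (g : X → ℝ) :
    empRisk2 P ℓ a S g ≤ empRisk1 P ℓ a S g := by
  rw [empRisk1_eq]
  exact le_add_of_nonneg_right (mul_nonneg ha (le_max_left _ _))

/-- The increments of the empirical risks when the samples change. -/
def riskDist (P : Measure (X × ℤˣ)) (a C : ℝ) (S T : Samples X np nn nu) : ℝ :=
  sampleDist ((1 - a) * prior P 1 * (C / np)) ((1 + a) * prior P (-1) * (C / nn)) (a * (C / nu)) S T

/-- The negative sample enters with weight `π_n` through the label `-1` and with weight `a π_n`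
through the label `1`, whence the factor `1 + a` in `riskDist`. -/
lemma empRisk2_sub_le (hπ : ∀ y, 0 < prior P y) (ha : a ∈ Ioo (0 : ℝ) 1)
    (hC : ∀ t y, ℓ t y ∈ Icc 0 C) (g : X → ℝ) (S T : Samples X np nn nu) :
    empRisk2 P ℓ a S g - empRisk2 P ℓ a T g ≤ riskDist P a C S T := by
  have h1 := mul_le_mul_of_nonneg_left ((le_abs_self _).trans (abs_empMean_sub_le hC 1 S.1 T.1 g))
    (mul_nonneg (sub_nonneg.2 ha.2.le) (hπ 1).le)
  have h2 := mul_le_mul_of_nonneg_left ((le_abs_self _).trans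
    (abs_empMean_sub_le hC (-1) S.2.1 T.2.1 g)) (hπ (-1)).le
  have h3 := mul_le_mul_of_nonneg_left ((neg_abs_le _).trans' (neg_le_neg
    (abs_empMean_sub_le hC 1 S.2.1 T.2.1 g))) (mul_nonneg ha.1.le (hπ (-1)).le)
  have h4 := mul_le_mul_of_nonneg_left ((le_abs_self _).trans
    (abs_empMean_sub_le hC 1 S.2.2 T.2.2 g)) ha.1.le
  simp only [riskDist, sampleDist, weightedHamming_mul, empRisk2]
  linarith

/-- Clipping is 1-Lipschitz, so the increments are bounded as for the unclipped estimator. -/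
lemma empRisk1_sub_le (hπ : ∀ y, 0 < prior P y) (ha : a ∈ Ioo (0 : ℝ) 1)
    (hC : ∀ t y, ℓ t y ∈ Icc 0 C) (g : X → ℝ) (S T : Samples X np nn nu) :
    empRisk1 P ℓ a S g - empRisk1 P ℓ a T g ≤ riskDist P a C S T := by
  have h1 := mul_le_mul_of_nonneg_left ((le_abs_self _).trans (abs_empMean_sub_le hC 1 S.1 T.1 g))
    (mul_nonneg (sub_nonneg.2 ha.2.le) (hπ 1).le)
  have h2 := mul_le_mul_of_nonneg_left ((le_abs_self _).trans
    (abs_empMean_sub_le hC (-1) S.2.1 T.2.1 g)) (hπ (-1)).le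
  have h3 := mul_le_mul_of_nonneg_left ((neg_abs_le _).trans' (neg_le_neg
    (abs_empMean_sub_le hC 1 S.2.1 T.2.1 g))) (hπ (-1)).le
  have h4 := (le_abs_self _).trans (abs_empMean_sub_le hC 1 S.2.2 T.2.2 g)
  set A := empMean ℓ 1 S.2.2 g - prior P (-1) * empMean ℓ 1 S.2.1 g with hA
  set B := empMean ℓ 1 T.2.2 g - prior P (-1) * empMean ℓ 1 T.2.1 g with hB
  have h5 : max 0 A ≤ max 0 B + (weightedHamming (C / nu) S.2.2 T.2.2
      + prior P (-1) * weightedHamming (C / nn) S.2.1 T.2.1) := by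
    have h6 := (abs_nonneg _).trans (abs_empMean_sub_le hC 1 S.2.2 T.2.2 g)
    have h7 := mul_nonneg (hπ (-1)).le
      ((abs_nonneg _).trans (abs_empMean_sub_le hC 1 S.2.1 T.2.1 g))
    refine max_le (by linarith [le_max_left 0 B]) ?_
    have := le_max_right 0 B
    linarith
  have h6 := mul_le_mul_of_nonneg_left h5 ha.1.le
  simp only [riskDist, sampleDist, weightedHamming_mul, empRisk1, ← hA, ← hB]
  linarith

lemma abs_empRisk2_le (hπ : ∀ y, 0 < prior P y) (ha : a ∈ Ioo (0 : ℝ) 1)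
    (hC : ∀ t y, ℓ t y ∈ Icc 0 C) (g : X → ℝ) (S : Samples X np nn nu) :
    |empRisk2 P ℓ a S g| ≤
      a * C + (1 - a) * prior P 1 * C + prior P (-1) * C + a * prior P (-1) * C := by
  have ha1 := sub_nonneg.2 ha.2.le
  have bound : ∀ {k e : ℝ}, 0 ≤ k → e ∈ Icc 0 C → 0 ≤ k * e ∧ k * e ≤ k * C := fun hk he =>
    ⟨mul_nonneg hk he.1, mul_le_mul_of_nonneg_left he.2 hk⟩
  have h1 := bound (mul_nonneg ha1 (hπ 1).le) (empMean_mem hC 1 S.1 g)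
  have h2 := bound (hπ (-1)).le (empMean_mem hC (-1) S.2.1 g)
  have h3 := bound (mul_nonneg ha.1.le (hπ (-1)).le) (empMean_mem hC 1 S.2.1 g)
  have h4 := bound ha.1.le (empMean_mem hC 1 S.2.2 g)
  unfold empRisk2
  exact abs_le.2 ⟨by linarith, by linarith⟩

lemma abs_empRisk1_le (hπ : ∀ y, 0 < prior P y) (ha : a ∈ Ioo (0 : ℝ) 1)
    (hC : ∀ t y, ℓ t y ∈ Icc 0 C) (g : X → ℝ) (S : Samples X np nn nu) :
    |empRisk1 P ℓ a S g| ≤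
      a * C + (1 - a) * prior P 1 * C + prior P (-1) * C + a * prior P (-1) * C
        + a * (prior P (-1) * C) := by
  have h1 := abs_empRisk2_le hπ ha hC g S
  have h2 := empMean_mem hC 1 S.2.1 g
  have h3 := empMean_mem hC 1 S.2.2 g
  have h4 := mul_le_mul_of_nonneg_left h2.2 (hπ (-1)).le
  have h5 : max 0 (prior P (-1) * empMean ℓ 1 S.2.1 g - empMean ℓ 1 S.2.2 g) ≤ prior P (-1) * C :=
    max_le (mul_nonneg (hπ (-1)).le (h2.1.trans h2.2)) (by linarith [h3.1])
  rw [empRisk1_eq]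
  refine (abs_add_le _ _).trans (add_le_add h1 ?_)
  rw [abs_of_nonneg (mul_nonneg ha.1.le (le_max_left _ _))]
  exact mul_le_mul_of_nonneg_left h5 ha.1.le

/-- The second risk estimator is unbiased. -/
lemma integral_empRisk2 [IsProbabilityMeasure P] (hπ : ∀ y, 0 < prior P y)
    (hmeas : ∀ y, Measurable fun t => ℓ t y) (hC : ∀ t y, ℓ t y ∈ Icc 0 C) (hnp : 0 < np)
    (hnn : 0 < nn) (hnu : 0 < nu) {g : X → ℝ} (hg : Measurable g) :
    ∫ S, empRisk2 P ℓ a S g ∂(sampleLaw P np nn nu) = (risk P ℓ g).toReal := by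
  have := fun y => isProbabilityMeasure_classLaw (hπ y)
  have := isProbabilityMeasure_sampleLaw hπ np nn nu
  have mp := measurePreserving_positive (np := np) (nn := nn) (nu := nu) hπ
  have mn := measurePreserving_negative (np := np) (nn := nn) (nu := nu) hπ
  have mu := measurePreserving_unlabeled (np := np) (nn := nn) (nu := nu) hπ
  have i1 := (integrable_empMean_comp hmeas hC 1 hg mu.measurable
    (μ := sampleLaw P np nn nu)).const_mul a
  have i2 := (integrable_empMean_comp hmeas hC 1 hg mp.measurable
    (μ := sampleLaw P np nn nu)).const_mul ((1 - a) * prior P 1)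
  have i3 := (integrable_empMean_comp hmeas hC (-1) hg mn.measurable
    (μ := sampleLaw P np nn nu)).const_mul (prior P (-1))
  have i4 := (integrable_empMean_comp hmeas hC 1 hg mn.measurable
    (μ := sampleLaw P np nn nu)).const_mul (a * prior P (-1))
  have i12 : Integrable (fun S : Samples X np nn nu => a * empMean ℓ 1 S.2.2 g
      + (1 - a) * prior P 1 * empMean ℓ 1 S.1 g) (sampleLaw P np nn nu) := i1.add i2
  have i123 : Integrable (fun S : Samples X np nn nu => a * empMean ℓ 1 S.2.2 g
      + (1 - a) * prior P 1 * empMean ℓ 1 S.1 g + prior P (-1) * empMean ℓ (-1) S.2.1 g)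
      (sampleLaw P np nn nu) := i12.add i3
  unfold empRisk2
  rw [integral_sub i123 i4, integral_add i12 i3, integral_add i1 i2, integral_const_mul, integral_const_mul, integral_const_mul, integral_const_mul,
    integral_empMean_comp hmeas hC 1 hnu hg mu, integral_empMean_comp hmeas hC 1 hnp hg mp,
    integral_empMean_comp hmeas hC (-1) hnn hg mn, integral_empMean_comp hmeas hC 1 hnn hg mn,
    toReal_risk hπ hmeas hC hg, partialRisk_marginal hπ hmeas hC 1 hg]
  ring

/-- The bias of the nonnegative risk estimator. -/
lemma integral_empRisk1_le [IsProbabilityMeasure P] (hπ : ∀ y, 0 < prior P y)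
    (hmeas : ∀ y, Measurable fun t => ℓ t y) (hC : ∀ t y, ℓ t y ∈ Icc 0 C) (ha : a ∈ Ioo (0 : ℝ) 1)
    (hnp : 0 < np) (hnn : 0 < nn) (hnu : 0 < nu) {g : X → ℝ} (hg : Measurable g) {ρ : ℝ}
    (hρ : 0 < ρ) (hgρ : ρ ≤ partialRisk (classLaw P 1) ℓ 1 g) :
    ∫ S, empRisk1 P ℓ a S g ∂(sampleLaw P np nn nu) ≤
      (risk P ℓ g).toReal + biasTerm P a C ρ nn nu := by
  have := fun y => isProbabilityMeasure_classLaw (hπ y)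
  have := isProbabilityMeasure_sampleLaw hπ np nn nu
  have mn := measurePreserving_negative (np := np) (nn := nn) (nu := nu) hπ
  have mu := measurePreserving_unlabeled (np := np) (nn := nn) (nu := nu) hπ
  have hC0 : 0 ≤ C := (hC 0 1).1.trans (hC 0 1).2
  set μ := sampleLaw P np nn nu with hμ
  set h : Samples X np nn nu → ℝ := fun S =>
    prior P (-1) * empMean ℓ 1 S.2.1 g - empMean ℓ 1 S.2.2 g with hh
  have hm : Measurable h := (((measurable_empMean hmeas 1 hg).comp mn.measurable).const_mul _).sub
    ((measurable_empMean hmeas 1 hg).comp mu.measurable)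
  have hle : ∀ S, h S ≤ prior P (-1) * C := fun S => by
    have h1 := mul_le_mul_of_nonneg_left (empMean_mem hC 1 S.2.1 g).2 (hπ (-1)).le
    have h2 := (empMean_mem hC 1 S.2.2 g).1
    simp only [hh]; linarith
  have hge : ∀ S, -C ≤ h S := fun S => by
    have h1 := mul_nonneg (hπ (-1)).le (empMean_mem hC 1 S.2.1 g).1
    have h2 := (empMean_mem hC 1 S.2.2 g).2
    simp only [hh]; linarith
  have hmean : ∫ S, h S ∂μ = -(prior P 1 * partialRisk (classLaw P 1) ℓ 1 g) := by
    simp only [hh]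
    rw [integral_sub ((integrable_empMean_comp hmeas hC 1 hg mn.measurable).const_mul _)
      (integrable_empMean_comp hmeas hC 1 hg mu.measurable), integral_const_mul,
      integral_empMean_comp hmeas hC 1 hnn hg mn, integral_empMean_comp hmeas hC 1 hnu hg mu,
      partialRisk_marginal hπ hmeas hC 1 hg]
    ring
  -- `h` does not involve the positive sample, which therefore gets the weight `0`.
  have hconc := concentrates_sampleLaw (np := np) (nn := nn) (nu := nu) hπ le_rfl
    (mul_nonneg (hπ (-1)).le (div_nonneg hC0 (Nat.cast_nonneg nn)))
    (div_nonneg hC0 (Nat.cast_nonneg nu))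
  have hπρ : 0 ≤ prior P 1 * ρ := mul_nonneg (hπ 1).le hρ.le
  -- The mean of `h` is at most `-(π_p ρ)`, so `h ≥ 0` is a deviation of at least `π_p ρ`.
  have htail : μ.real {S | 0 ≤ h S} ≤ Real.exp (-(2 * prior P 1 ^ 2 * ρ ^ 2 /
      (C ^ 2 * (1 / (nu : ℝ) + prior P (-1) ^ 2 / (nn : ℝ))))) := by
    have h1 := hconc.measure_ge_le (by positivity) (f := h) (.of_measurable hm)
      (M := C + prior P (-1) * C) (fun S => by
        have := mul_nonneg (hπ (-1)).le hC0
        exact abs_le.2 ⟨by linarith [hge S], by linarith [hle S]⟩)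
      (fun S T => by
        have h1 := mul_le_mul_of_nonneg_left ((le_abs_self _).trans
          (abs_empMean_sub_le hC 1 S.2.1 T.2.1 g)) (hπ (-1)).le
        have h2 := (neg_abs_le _).trans' (neg_le_neg (abs_empMean_sub_le hC 1 S.2.2 T.2.2 g))
        have h3 : weightedHamming 0 S.1 T.1 = 0 := by simp [weightedHamming]
        simp only [hh, sampleDist, weightedHamming_mul, h3]
        linarith) hπρ
    refine (measureReal_mono fun S hS => ?_).trans (h1.trans_eq ?_)
    · have := mul_le_mul_of_nonneg_left hgρ (hπ 1).le
      have hS' : 0 ≤ h S := hS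
      show ∫ S, h S ∂μ + prior P 1 * ρ ≤ h S
      linarith
    · congr 1
      have e1 : (nn : ℝ) ≠ 0 := by positivity
      have e2 : (nu : ℝ) ≠ 0 := by positivity
      have e3 : 2 * ((np : ℝ) * 0 ^ 2 / 4 + (nn * (prior P (-1) * (C / nn)) ^ 2 / 4
          + nu * (C / nu) ^ 2 / 4)) =
          (C ^ 2 * (1 / (nu : ℝ) + prior P (-1) ^ 2 / (nn : ℝ))) / 2 := by
        field_simp; ring
      rw [e3, div_div_eq_mul_div, neg_mul, neg_div]
      congr 2
      ring
  -- The correction is at most `π_n C` and vanishes where `h` is negative.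
  have hmax : ∫ S, max 0 (h S) ∂μ ≤ prior P (-1) * C * μ.real {S | 0 ≤ h S} := by
    have hset : MeasurableSet {S | 0 ≤ h S} := measurableSet_le measurable_const hm
    calc ∫ S, max 0 (h S) ∂μ ≤ ∫ S, {S | 0 ≤ h S}.indicator (fun _ => prior P (-1) * C) S ∂μ := by
          refine integral_mono (integrable_of_mem_Icc_zero (measurable_const.max hm)
            (C := prior P (-1) * C) fun S => ⟨le_max_left _ _, max_le
              (mul_nonneg (hπ (-1)).le hC0) (hle S)⟩)
            ((integrable_const _).indicator hset) fun S => ?_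
          by_cases hS : 0 ≤ h S
          · rw [max_eq_right hS, indicator_of_mem (show S ∈ {S | 0 ≤ h S} from hS)]; exact hle S
          · rw [max_eq_left (not_le.1 hS).le,
              indicator_of_notMem (show S ∉ {S | 0 ≤ h S} from hS)]
      _ = _ := by rw [integral_indicator_const _ hset, smul_eq_mul, mul_comm]
  have hint2 : Integrable (fun S => empRisk2 P ℓ a S g) μ :=
    (UnivMeas.of_measurable (measurable_empRisk2 hmeas hg)).integrable
      (abs_empRisk2_le hπ ha hC g) μ
  have hint : Integrable (fun S => max 0 (h S)) μ := integrable_of_mem_Icc_zero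
    (measurable_const.max hm) (C := prior P (-1) * C) fun S => ⟨le_max_left _ _, max_le
      (mul_nonneg (hπ (-1)).le hC0) (hle S)⟩
  have hsplit : ∫ S, empRisk1 P ℓ a S g ∂μ =
      (risk P ℓ g).toReal + a * ∫ S, max 0 (h S) ∂μ := by
    simp_rw [empRisk1_eq]
    rw [integral_add hint2 (hint.const_mul a), integral_const_mul,
      integral_empRisk2 hπ hmeas hC hnp hnn hnu hg]
  rw [hsplit, biasTerm]
  have h1 := mul_le_mul_of_nonneg_left (hmax.trans (mul_le_mul_of_nonneg_left htail
    (mul_nonneg (hπ (-1)).le hC0))) ha.1.le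
  linarith

end Estimation

section UniformDeviation

variable {X : Type*} [MeasurableSpace X] {P : Measure (X × ℤˣ)} {ℓ : Loss} {a C : ℝ}
  {𝒢 : Set (X → ℝ)} {np nn nu : ℕ}

/-! ### The uniform deviation of the empirical risk -/

/-- The supremum over `𝒢` of the difference of the empirical risks of two triples of samples. -/
def ghostSup (P : Measure (X × ℤˣ)) (ℓ : Loss) (a : ℝ) (𝒢 : Set (X → ℝ))
    (w : Samples X np nn nu × Samples X np nn nu) : ℝ :=
  ⨆ g : 𝒢, (empRisk2 P ℓ a w.2 g.1 - empRisk2 P ℓ a w.1 g.1)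

/-- A measurable majorant of the supremum over `𝒢` of the deviations of the empirical risk from
the risk: the expectation over a ghost sample of the supremum of the differences. -/
def uniformDev (P : Measure (X × ℤˣ)) (ℓ : Loss) (a : ℝ) (𝒢 : Set (X → ℝ))
    (S : Samples X np nn nu) : ℝ :=
  ∫ T, ghostSup P ℓ a 𝒢 (S, T) ∂(sampleLaw P np nn nu)

lemma univMeas_ghostSup (hcont : ∀ y, Continuous fun t => ℓ t y) (hsup : MeasurableSuprema 𝒢) :
    UnivMeas (ghostSup (np := np) (nn := nn) (nu := nu) P ℓ a 𝒢) := by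
  set E : (Fin np ⊕ Fin nn ⊕ Fin nu → ℝ) → ℝ := fun v =>
    a * ((1 / (nu : ℝ)) * ∑ i, ℓ (v (.inr (.inr i))) 1)
      + (1 - a) * prior P 1 * ((1 / (np : ℝ)) * ∑ i, ℓ (v (.inl i)) 1)
      + prior P (-1) * ((1 / (nn : ℝ)) * ∑ i, ℓ (v (.inr (.inl i))) (-1))
      - a * prior P (-1) * ((1 / (nn : ℝ)) * ∑ i, ℓ (v (.inr (.inl i))) 1) with hE
  have h1 := hcont 1
  have h2 := hcont (-1)
  have hEc : Continuous E := by fun_prop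
  have hr : Continuous fun v : (Fin np ⊕ Fin nn ⊕ Fin nu) ⊕ (Fin np ⊕ Fin nn ⊕ Fin nu) → ℝ =>
    E (fun i => v (.inr i)) := hEc.comp (f := fun (v : _ ⊕ _ → ℝ) i => v (.inr i)) (continuous_pi fun i => continuous_apply _)
  have hl : Continuous fun v : (Fin np ⊕ Fin nn ⊕ Fin nu) ⊕ (Fin np ⊕ Fin nn ⊕ Fin nu) → ℝ =>
    E (fun i => v (.inl i)) := hEc.comp (f := fun (v : _ ⊕ _ → ℝ) i => v (.inl i)) (continuous_pi fun i => continuous_apply _)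
  have := hsup.univMeas (F := fun v : (Fin np ⊕ Fin nn ⊕ Fin nu) ⊕ (Fin np ⊕ Fin nn ⊕ Fin nu) → ℝ =>
      E (fun i => v (.inr i)) - E (fun i => v (.inl i)))
    (hr.sub hl)
    (z := fun w : Samples X np nn nu × Samples X np nn nu =>
      Sum.elim (Sum.elim w.1.1 (Sum.elim w.1.2.1 w.1.2.2))
        (Sum.elim w.2.1 (Sum.elim w.2.2.1 w.2.2.2))) (by
      rintro ((i | i | i) | (i | i | i)) <;> simp only [Sum.elim_inl, Sum.elim_inr] <;> fun_prop)
  exact this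

lemma exists_abs_empRisk2_sub_le (hπ : ∀ y, 0 < prior P y) (ha : a ∈ Ioo (0 : ℝ) 1)
    (hC : ∀ t y, ℓ t y ∈ Icc 0 C) :
    ∃ M, ∀ (S T : Samples X np nn nu) (g : X → ℝ),
      |empRisk2 P ℓ a T g - empRisk2 P ℓ a S g| ≤ M :=
  ⟨_, fun S T g => (abs_sub _ _).trans
    (add_le_add (abs_empRisk2_le hπ ha hC g T) (abs_empRisk2_le hπ ha hC g S))⟩

lemma exists_abs_ghostSup_le (hπ : ∀ y, 0 < prior P y) (ha : a ∈ Ioo (0 : ℝ) 1)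
    (hC : ∀ t y, ℓ t y ∈ Icc 0 C) (hne : 𝒢.Nonempty) :
    ∃ M, ∀ w, |ghostSup (np := np) (nn := nn) (nu := nu) P ℓ a 𝒢 w| ≤ M := by
  have := hne.to_subtype
  obtain ⟨M, hM⟩ := exists_abs_empRisk2_sub_le (np := np) (nn := nn) (nu := nu) hπ ha hC
  exact ⟨M, fun w => abs_ciSup_le_of_abs_le fun g => hM _ _ _⟩

lemma univMeas_uniformDev [IsProbabilityMeasure P] (hπ : ∀ y, 0 < prior P y)
    (hcont : ∀ y, Continuous fun t => ℓ t y) (hsup : MeasurableSuprema 𝒢) :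
    UnivMeas (uniformDev (np := np) (nn := nn) (nu := nu) P ℓ a 𝒢) := by
  have := isProbabilityMeasure_sampleLaw hπ np nn nu
  exact (univMeas_ghostSup hcont hsup).integral_right _

/-- By unbiasedness the risk is the mean of `empRisk2` over a ghost sample, and each difference
under that mean is at most the supremum. -/
lemma risk_le_empRisk2_add_uniformDev [IsProbabilityMeasure P] (hπ : ∀ y, 0 < prior P y)
    (ha : a ∈ Ioo (0 : ℝ) 1) (hcont : ∀ y, Continuous fun t => ℓ t y)
    (hC : ∀ t y, ℓ t y ∈ Icc 0 C) (hsup : MeasurableSuprema 𝒢) (hnp : 0 < np) (hnn : 0 < nn)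
    (hnu : 0 < nu) {g : X → ℝ} (hg : g ∈ 𝒢) (hgm : Measurable g) (S : Samples X np nn nu) :
    (risk P ℓ g).toReal ≤ empRisk2 P ℓ a S g + uniformDev P ℓ a 𝒢 S := by
  have := isProbabilityMeasure_sampleLaw hπ np nn nu
  obtain ⟨M, hM⟩ := exists_abs_empRisk2_sub_le (np := np) (nn := nn) (nu := nu) hπ ha hC
  obtain ⟨M', hM'⟩ := exists_abs_ghostSup_le (np := np) (nn := nn) (nu := nu) hπ ha hC ⟨g, hg⟩
  have hint : Integrable (fun T => empRisk2 P ℓ a T g) (sampleLaw P np nn nu) :=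
    (UnivMeas.of_measurable (measurable_empRisk2 (fun y => (hcont y).measurable) hgm)).integrable
      (abs_empRisk2_le hπ ha hC g) _
  have h1 : ∫ T, (empRisk2 P ℓ a T g - empRisk2 P ℓ a S g) ∂(sampleLaw P np nn nu) ≤
      uniformDev P ℓ a 𝒢 S := by
    refine integral_mono (hint.sub (integrable_const _))
      (((univMeas_ghostSup hcont hsup).comp measurable_prodMk_left).integrable
        (fun T => hM' (S, T)) _) fun T => ?_
    exact le_ciSup (f := fun g : 𝒢 => empRisk2 P ℓ a T g.1 - empRisk2 P ℓ a S g.1)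
      (bddAbove_range_of_abs_le fun g => hM S T g.1) ⟨g, hg⟩
  rw [integral_sub hint (integrable_const _), integral_empRisk2 hπ
    (fun y => (hcont y).measurable) hC hnp hnn hnu hgm] at h1
  simp only [integral_const, probReal_univ, one_smul] at h1
  linarith

/-- The sample enters only through `-empRisk2`, inside a supremum and an average, neither of which
enlarges increments; the sign reverses the order of the two samples. -/
lemma uniformDev_sub_le [IsProbabilityMeasure P] (hπ : ∀ y, 0 < prior P y)
    (ha : a ∈ Ioo (0 : ℝ) 1) (hcont : ∀ y, Continuous fun t => ℓ t y)
    (hC : ∀ t y, ℓ t y ∈ Icc 0 C) (hsup : MeasurableSuprema 𝒢) (hne : 𝒢.Nonempty)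
    (S T : Samples X np nn nu) :
    uniformDev P ℓ a 𝒢 S - uniformDev P ℓ a 𝒢 T ≤ riskDist P a C T S := by
  have := hne.to_subtype
  have := isProbabilityMeasure_sampleLaw hπ np nn nu
  obtain ⟨M, hM⟩ := exists_abs_empRisk2_sub_le (np := np) (nn := nn) (nu := nu) hπ ha hC
  obtain ⟨M', hM'⟩ := exists_abs_ghostSup_le (np := np) (nn := nn) (nu := nu) hπ ha hC hne
  have hint : ∀ S, Integrable (fun U => ghostSup P ℓ a 𝒢 (S, U)) (sampleLaw P np nn nu) :=
    fun S => ((univMeas_ghostSup hcont hsup).comp measurable_prodMk_left).integrable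
      (fun U => hM' (S, U)) _
  rw [sub_le_iff_le_add]
  calc uniformDev P ℓ a 𝒢 S
      ≤ ∫ U, (riskDist P a C T S + ghostSup P ℓ a 𝒢 (T, U)) ∂(sampleLaw P np nn nu) := by
        refine integral_mono (hint S) ((integrable_const _).add (hint T)) fun U => ?_
        refine ciSup_le fun g => ?_
        have h1 := empRisk2_sub_le hπ ha hC g.1 T S
        have h2 := le_ciSup (f := fun g : 𝒢 => empRisk2 P ℓ a U g.1 - empRisk2 P ℓ a T g.1)
          (bddAbove_range_of_abs_le fun g => hM T U g.1) g
        have h3 : empRisk2 P ℓ a U g.1 - empRisk2 P ℓ a T g.1 ≤ ghostSup P ℓ a 𝒢 (T, U) := h2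
        show empRisk2 P ℓ a U g.1 - empRisk2 P ℓ a S g.1 ≤ _
        linarith
    _ = _ := by
        rw [integral_add (integrable_const _) (hint T)]
        simp [uniformDev]

/-- The expected supremum of the difference of the empirical means of two independent samples
contained in a pair of triples of samples. -/
lemma integral_iSup_empMean_sub_le (hsup : MeasurableSuprema 𝒢) {Cg : ℝ}
    (hCg : ∀ g ∈ 𝒢, ∀ x, |g x| ≤ Cg) (hne : 𝒢.Nonempty) {φ : ℝ → ℝ} (hφc : Continuous φ)
    {L B : ℝ} (hL : 0 ≤ L) (hφ : ∀ s t, |φ s - φ t| ≤ L * |s - t|) (hB : ∀ t, |φ t| ≤ B)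
    {n : ℕ} {q : Measure X} [IsProbabilityMeasure q] {Ω : Type*} [MeasurableSpace Ω]
    {μ : Measure Ω} [IsProbabilityMeasure μ] {z : Ω → Fin n → X}
    (hz : MeasurePreserving z μ (Measure.pi fun _ => q)) :
    ∃ D : Ω × Ω → ℝ, Integrable D (μ.prod μ) ∧
      (∀ w, ∀ g ∈ 𝒢, (1 / (n : ℝ)) * ∑ i, φ (g (z w.2 i)) - (1 / (n : ℝ)) * ∑ i, φ (g (z w.1 i))
        ≤ D w) ∧ ∫ w, D w ∂(μ.prod μ) ≤ 2 * L * rademacher n q 𝒢 := by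
  have := hne.to_subtype
  have hB0 : 0 ≤ B := (abs_nonneg _).trans (hB 0)
  set H : (Fin n → X) × (Fin n → X) → ℝ := fun w => ⨆ g : 𝒢,
    ((1 / (n : ℝ)) * ∑ i, φ (g.1 (w.2 i)) - (1 / (n : ℝ)) * ∑ i, φ (g.1 (w.1 i)))
  have hb : ∀ (w : (Fin n → X) × (Fin n → X)) (g : 𝒢), |(1 / (n : ℝ)) * ∑ i, φ (g.1 (w.2 i))
      - (1 / (n : ℝ)) * ∑ i, φ (g.1 (w.1 i))| ≤ B + B := fun w g =>
    (abs_sub _ _).trans (add_le_add (abs_mean_le hB0 fun i => hB _) (abs_mean_le hB0 fun i => hB _))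
  have hHm : UnivMeas H := by
    have := hsup.univMeas (ι := Fin n ⊕ Fin n) (F := fun v => (1 / (n : ℝ)) * ∑ i, φ (v (.inr i))
        - (1 / (n : ℝ)) * ∑ i, φ (v (.inl i))) (by fun_prop)
      (z := fun w : (Fin n → X) × (Fin n → X) => Sum.elim w.1 w.2) (by
        rintro (i | i)
        · exact (measurable_pi_apply i).comp measurable_fst
        · exact (measurable_pi_apply i).comp measurable_snd)
    exact this
  have hHB : ∀ w, |H w| ≤ B + B := fun w => abs_ciSup_le_of_abs_le (hb w)
  have hmp := hz.prod hz
  refine ⟨fun w => H (Prod.map z z w), (hHm.comp hmp.measurable).integrable (fun w => hHB _) _,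
    fun w g hg => ?_, ?_⟩
  · exact le_ciSup (f := fun g : 𝒢 => (1 / (n : ℝ)) * ∑ i, φ (g.1 (z w.2 i))
      - (1 / (n : ℝ)) * ∑ i, φ (g.1 (z w.1 i)))
      (bddAbove_range_of_abs_le (hb (z w.1, z w.2))) ⟨g, hg⟩
  · have h1 := integral_map hmp.measurable.aemeasurable
      (by rw [hmp.map_eq]; exact (hHm _).aestronglyMeasurable : AEStronglyMeasurable H _)
    rw [hmp.map_eq] at h1
    rw [← h1]
    exact integral_iSup_mean_sub_mean_le hsup hCg hne hφc hL hφ hB n q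

/-- The supremum is split over the four empirical means, each bounded by symmetrization with its own
weight. The one with a negative coefficient is treated with `φ = -ℓ(·, 1)`; its weight `a π_n` joins
`π_n` to give `(1 + a) π_n`. -/
lemma integral_uniformDev_le [IsProbabilityMeasure P] (hπ : ∀ y, 0 < prior P y)
    (ha : a ∈ Ioo (0 : ℝ) 1) (hcont : ∀ y, Continuous fun t => ℓ t y)
    (hC : ∀ t y, ℓ t y ∈ Icc 0 C) {L : ℝ} (hL : 0 ≤ L)
    (hlip : ∀ y s t, |ℓ s y - ℓ t y| ≤ L * |s - t|) (hsup : MeasurableSuprema 𝒢)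
    {Cg : ℝ} (hCg : ∀ g ∈ 𝒢, ∀ x, |g x| ≤ Cg) (hne : 𝒢.Nonempty) :
    ∫ S, uniformDev P ℓ a 𝒢 S ∂(sampleLaw P np nn nu) ≤
      2 * L * rademacherSum P 𝒢 a np nn nu := by
  have := hne.to_subtype
  have := fun y => isProbabilityMeasure_classLaw (hπ y)
  have := isProbabilityMeasure_sampleLaw hπ np nn nu
  have mp := measurePreserving_positive (np := np) (nn := nn) (nu := nu) hπ
  have mn := measurePreserving_negative (np := np) (nn := nn) (nu := nu) hπ
  have mu := measurePreserving_unlabeled (np := np) (nn := nn) (nu := nu) hπ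
  obtain ⟨M', hM'⟩ := exists_abs_ghostSup_le (np := np) (nn := nn) (nu := nu) hπ ha hC hne
  have habs : ∀ t y, |ℓ t y| ≤ C := fun t y => by
    rw [abs_of_nonneg (hC t y).1]; exact (hC t y).2
  set μ := sampleLaw P np nn nu with hμ
  have hghost : Integrable (ghostSup P ℓ a 𝒢) (μ.prod μ) :=
    (univMeas_ghostSup hcont hsup).integrable hM' _
  have hswap : ∫ S, uniformDev P ℓ a 𝒢 S ∂μ = ∫ w, ghostSup P ℓ a 𝒢 w ∂(μ.prod μ) :=
    (integral_prod _ hghost).symm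
  obtain ⟨D₁, i₁, h₁, b₁⟩ := integral_iSup_empMean_sub_le hsup hCg hne (hcont 1) hL (hlip 1)
    (fun t => habs t 1) mu
  obtain ⟨D₂, i₂, h₂, b₂⟩ := integral_iSup_empMean_sub_le hsup hCg hne (hcont 1) hL (hlip 1)
    (fun t => habs t 1) mp
  obtain ⟨D₃, i₃, h₃, b₃⟩ := integral_iSup_empMean_sub_le hsup hCg hne (hcont (-1)) hL (hlip (-1))
    (fun t => habs t (-1)) mn
  obtain ⟨D₄, i₄, h₄, b₄⟩ := integral_iSup_empMean_sub_le (φ := fun t => -ℓ t 1) hsup hCg hne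
    (hcont 1).neg hL (fun s t => by rw [← neg_sub', abs_neg]; exact hlip 1 s t)
    (fun t => by rw [abs_neg]; exact habs t 1) mn
  have c₂ : 0 ≤ (1 - a) * prior P 1 := mul_nonneg (sub_nonneg.2 ha.2.le) (hπ 1).le
  have c₃ := (hπ (-1)).le
  have c₄ : 0 ≤ a * prior P (-1) := mul_nonneg ha.1.le c₃
  have hle : ∀ w, ghostSup P ℓ a 𝒢 w ≤ a * D₁ w + (1 - a) * prior P 1 * D₂ w
      + prior P (-1) * D₃ w + a * prior P (-1) * D₄ w := by
    intro w
    refine ciSup_le fun g => ?_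
    have e₁ := mul_le_mul_of_nonneg_left (h₁ w g.1 g.2) ha.1.le
    have e₂ := mul_le_mul_of_nonneg_left (h₂ w g.1 g.2) c₂
    have e₃ := mul_le_mul_of_nonneg_left (h₃ w g.1 g.2) c₃
    have e₄ := mul_le_mul_of_nonneg_left (h₄ w g.1 g.2) c₄
    simp only [Finset.sum_neg_distrib] at e₄
    simp only [empRisk2, empMean]
    linarith
  have j₁ := i₁.const_mul a
  have j₂ := i₂.const_mul ((1 - a) * prior P 1)
  have j₃ := i₃.const_mul (prior P (-1))
  have j₄ := i₄.const_mul (a * prior P (-1))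
  have j₁₂ : Integrable (fun w => a * D₁ w + (1 - a) * prior P 1 * D₂ w) (μ.prod μ) := j₁.add j₂
  have j₁₂₃ : Integrable (fun w => a * D₁ w + (1 - a) * prior P 1 * D₂ w
    + prior P (-1) * D₃ w) (μ.prod μ) := j₁₂.add j₃
  have h := integral_mono hghost (j₁₂₃.add j₄) hle
  have hsplit : ∫ w, (a * D₁ w + (1 - a) * prior P 1 * D₂ w + prior P (-1) * D₃ w
      + a * prior P (-1) * D₄ w) ∂(μ.prod μ) = a * ∫ w, D₁ w ∂(μ.prod μ)
      + (1 - a) * prior P 1 * ∫ w, D₂ w ∂(μ.prod μ) + prior P (-1) * ∫ w, D₃ w ∂(μ.prod μ)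
      + a * prior P (-1) * ∫ w, D₄ w ∂(μ.prod μ) := by
    rw [integral_add j₁₂₃ j₄, integral_add j₁₂ j₃, integral_add j₁ j₂, integral_const_mul,
      integral_const_mul, integral_const_mul, integral_const_mul]
  have h' := h.trans_eq hsplit
  have e₁ := mul_le_mul_of_nonneg_left b₁ ha.1.le
  have e₂ := mul_le_mul_of_nonneg_left b₂ c₂
  have e₃ := mul_le_mul_of_nonneg_left b₃ c₃
  have e₄ := mul_le_mul_of_nonneg_left b₄ c₄
  rw [hswap, rademacherSum]
  linarith

/-! ### The estimation error -/

lemma rateSum_pos (hπ : ∀ y, 0 < prior P y) (ha : a ∈ Ioo (0 : ℝ) 1) (hnu : 0 < nu) :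
    0 < rateSum P a np nn nu := by
  have h1 := hπ 1
  have h2 := hπ (-1)
  have h3 := ha.1
  have h4 := sub_pos.2 ha.2
  have : 0 < a / √(nu : ℝ) := by positivity
  have : 0 ≤ (1 + a) * prior P (-1) / √(nn : ℝ) := by positivity
  have : 0 ≤ (1 - a) * prior P 1 / √(np : ℝ) := by positivity
  unfold rateSum
  linarith

/-- Functions of the samples whose increments are at most twice those of the empirical risks
exceed their means with small probability only. -/
lemma measure_uniformDev_add_ge_le [IsProbabilityMeasure P] (hπ : ∀ y, 0 < prior P y)
    (ha : a ∈ Ioo (0 : ℝ) 1) (hC0 : 0 < C) (hnu : 0 < nu)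
    {f : Samples X np nn nu → ℝ} (hf : UnivMeas f) {M : ℝ} (hM : ∀ S, |f S| ≤ M)
    (hfD : ∀ S T, f S - f T ≤ 2 * riskDist P a C S T) {κ : ℝ} (hκ : 1 ≤ κ) :
    (sampleLaw P np nn nu).real {S | ∫ T, f T ∂(sampleLaw P np nn nu)
      + 2 * C * √(Real.log κ / 2) * rateSum P a np nn nu ≤ f S} ≤ 1 / κ := by
  have := isProbabilityMeasure_sampleLaw hπ np nn nu
  have h1 := hπ 1
  have h2 := hπ (-1)
  have h3 := ha.1
  have h4 := sub_pos.2 ha.2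
  have hr := rateSum_pos (np := np) (nn := nn) hπ ha hnu
  have hlog := Real.log_nonneg hκ
  have hconc := concentrates_sampleLaw (np := np) (nn := nn) (nu := nu) hπ
    (cp := 2 * ((1 - a) * prior P 1 * (C / np))) (cn := 2 * ((1 + a) * prior P (-1) * (C / nn)))
    (cu := 2 * (a * (C / nu))) (by positivity) (by positivity) (by positivity)
  have key : ∀ (n : ℕ) (b : ℝ), n * (2 * (b * (C / n))) ^ 2 / 4 = C ^ 2 * (b / √(n : ℝ)) ^ 2 := by
    intro n b
    rcases n.eq_zero_or_pos with rfl | hn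
    · simp
    · have : (n : ℝ) ≠ 0 := by positivity
      rw [div_pow, Real.sq_sqrt (Nat.cast_nonneg n)]
      field_simp
      ring
  -- The variance is `C ^ 2` times the sum of the squares of the terms of `rateSum`, hence at most
  -- `C ^ 2` times the square of their sum.
  have hv : (np : ℝ) * (2 * ((1 - a) * prior P 1 * (C / np))) ^ 2 / 4
      + (nn * (2 * ((1 + a) * prior P (-1) * (C / nn))) ^ 2 / 4
        + nu * (2 * (a * (C / nu))) ^ 2 / 4) ≤ (C * rateSum P a np nn nu) ^ 2 := by
    rw [key, key, key, mul_pow, ← mul_add, ← mul_add]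
    gcongr
    have e1 : 0 ≤ (1 + a) * prior P (-1) / √(nn : ℝ) := by positivity
    have e2 : 0 ≤ (1 - a) * prior P 1 / √(np : ℝ) := by positivity
    have e3 : 0 ≤ a / √(nu : ℝ) := by positivity
    unfold rateSum
    nlinarith [mul_nonneg e1 e2, mul_nonneg e1 e3, mul_nonneg e2 e3]
  have hconc' := hconc.mono (D' := fun S T => 2 * riskDist P a C S T) (fun S T => by
    simp only [riskDist, sampleDist, weightedHamming_mul]; linarith) hv
  have h := hconc'.measure_ge_le (sq_nonneg _) hf hM hfD
    (s := 2 * C * √(Real.log κ / 2) * rateSum P a np nn nu) (by positivity)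
  refine h.trans_eq ?_
  -- The deviation is chosen so that the exponent is exactly `-log κ`.
  have e : -(2 * C * √(Real.log κ / 2) * rateSum P a np nn nu) ^ 2
      / (2 * (C * rateSum P a np nn nu) ^ 2) = -Real.log κ := by
    have : (2 * C * √(Real.log κ / 2) * rateSum P a np nn nu) ^ 2 =
        2 * (C * rateSum P a np nn nu) ^ 2 * Real.log κ := by
      rw [mul_pow, mul_pow, Real.sq_sqrt (by positivity)]; ring
    rw [this, neg_div, mul_div_assoc, mul_div_cancel₀]
    positivity
  rw [e, Real.exp_neg, Real.exp_log (by linarith), one_div]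

/-- The estimation error bounds for a globally bounded Lipschitz loss. -/
lemma exists_event_estimation [IsProbabilityMeasure P] (hπ : ∀ y, 0 < prior P y)
    (ha : a ∈ Ioo (0 : ℝ) 1) (hC0 : 0 < C) (hC : ∀ t y, ℓ t y ∈ Icc 0 C) {L : ℝ} (hL : 0 ≤ L)
    (hlip : ∀ y s t, |ℓ s y - ℓ t y| ≤ L * |s - t|) (hsup : MeasurableSuprema 𝒢)
    (hmeas : ∀ g ∈ 𝒢, Measurable g) {Cg : ℝ} (hCg : ∀ g ∈ 𝒢, ∀ x, |g x| ≤ Cg)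
    {gstar : X → ℝ} (hgstar : gstar ∈ 𝒢) (hnp : 0 < np) (hnn : 0 < nn) (hnu : 0 < nu) {δ : ℝ}
    (hδ : 0 < δ) :
    ∃ E : Set (Samples X np nn nu), MeasurableSet E ∧
      ENNReal.ofReal (1 - δ) ≤ sampleLaw P np nn nu E ∧ ∀ S ∈ E, ∀ g ∈ 𝒢,
        (∀ ρ, 0 < ρ → ρ ≤ partialRisk (classLaw P 1) ℓ 1 gstar →
          empRisk1 P ℓ a S g ≤ empRisk1 P ℓ a S gstar →
          (risk P ℓ g).toReal ≤
            (risk P ℓ gstar).toReal + bound1 P 𝒢 a C L ρ δ np nn nu) ∧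
        (empRisk2 P ℓ a S g ≤ empRisk2 P ℓ a S gstar →
          (risk P ℓ g).toReal ≤ (risk P ℓ gstar).toReal + bound2 P 𝒢 a C L δ np nn nu) := by
  have hprob := isProbabilityMeasure_sampleLaw hπ np nn nu
  rcases le_or_gt 1 δ with h1 | h1
  -- For `δ ≥ 1` the required probability is zero.
  · exact ⟨∅, .empty, by simp [h1], by simp⟩
  have hne : 𝒢.Nonempty := ⟨gstar, hgstar⟩
  have hcont : ∀ y, Continuous fun t => ℓ t y := fun y =>
    (LipschitzWith.of_dist_le_mul (K := ⟨L, hL⟩) fun s t => hlip y s t).continuous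
  have hlm : ∀ y, Measurable fun t => ℓ t y := fun y => (hcont y).measurable
  have hgm := hmeas gstar hgstar
  set μ := sampleLaw P np nn nu with hμ
  obtain ⟨M, hM⟩ := exists_abs_ghostSup_le (np := np) (nn := nn) (nu := nu) hπ ha hC hne
  have hdevM : ∀ S, |uniformDev (np := np) (nn := nn) (nu := nu) P ℓ a 𝒢 S| ≤ M := fun S =>
    abs_integral_le_of_bound (fun T => hM (S, T)) _
  have hdevm := univMeas_uniformDev (np := np) (nn := nn) (nu := nu) (a := a) hπ hcont hsup
  have hdev := integral_uniformDev_le (np := np) (nn := nn) (nu := nu) hπ ha hcont hC hL hlip hsup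
    hCg hne
  have hdevint := hdevm.integrable hdevM μ
  have hsymm : ∀ S T : Samples X np nn nu, riskDist P a C S T = riskDist P a C T S := fun S T => by
    simp only [riskDist, sampleDist, weightedHamming_comm _ S.1, weightedHamming_comm _ S.2.1,
      weightedHamming_comm _ S.2.2]
  have hdevD : ∀ S T : Samples X np nn nu,
      uniformDev P ℓ a 𝒢 S - uniformDev P ℓ a 𝒢 T ≤ riskDist P a C S T := fun S T => by
    rw [hsymm]; exact uniformDev_sub_le hπ ha hcont hC hsup hne S T
  have m1 : UnivMeas fun S : Samples X np nn nu => empRisk1 P ℓ a S gstar :=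
    .of_measurable (measurable_empRisk1 hlm hgm)
  have m2 : UnivMeas fun S : Samples X np nn nu => empRisk2 P ℓ a S gstar :=
    .of_measurable (measurable_empRisk2 hlm hgm)
  set f₁ : Samples X np nn nu → ℝ := fun S => uniformDev P ℓ a 𝒢 S + empRisk1 P ℓ a S gstar
    with hf₁
  set f₂ : Samples X np nn nu → ℝ := fun S => uniformDev P ℓ a 𝒢 S + empRisk2 P ℓ a S gstar
    with hf₂
  have hmean₁ : ∫ S, f₁ S ∂μ = ∫ S, uniformDev P ℓ a 𝒢 S ∂μ + ∫ S, empRisk1 P ℓ a S gstar ∂μ :=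
    integral_add hdevint (m1.integrable (abs_empRisk1_le hπ ha hC gstar) μ)
  have hmean₂ : ∫ S, f₂ S ∂μ = ∫ S, uniformDev P ℓ a 𝒢 S ∂μ + (risk P ℓ gstar).toReal := by
    rw [← integral_empRisk2 (a := a) hπ hlm hC hnp hnn hnu hgm]
    exact integral_add hdevint (m2.integrable (abs_empRisk2_le hπ ha hC gstar) μ)
  have t₁ := measure_uniformDev_add_ge_le hπ ha hC0 hnu (hdevm.add m1)
    (fun S => (abs_add_le _ _).trans (add_le_add (hdevM S) (abs_empRisk1_le hπ ha hC gstar S)))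
    (fun S T => by
      have h1 := hdevD S T
      have h2 := empRisk1_sub_le hπ ha hC gstar S T
      linarith) (κ := 2 / δ) (by rw [le_div_iff₀ hδ]; linarith)
  have t₂ := measure_uniformDev_add_ge_le hπ ha hC0 hnu (hdevm.add m2)
    (fun S => (abs_add_le _ _).trans (add_le_add (hdevM S) (abs_empRisk2_le hπ ha hC gstar S)))
    (fun S T => by
      have h1 := hdevD S T
      have h2 := empRisk2_sub_le hπ ha hC gstar S T
      linarith) (κ := 6 / δ) (by rw [le_div_iff₀ hδ]; linarith)
  set bad₁ : Set (Samples X np nn nu) := {S | ∫ T, f₁ T ∂μ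
      + 2 * C * √(Real.log (2 / δ) / 2) * rateSum P a np nn nu ≤ f₁ S} with hbad₁
  set bad₂ : Set (Samples X np nn nu) := {S | ∫ T, f₂ T ∂μ
      + 2 * C * √(Real.log (6 / δ) / 2) * rateSum P a np nn nu ≤ f₂ S} with hbad₂
  -- The two exceptional sets have measure at most `δ / 2` and `δ / 6`.
  have hbad : μ (bad₁ ∪ bad₂) ≤ ENNReal.ofReal δ := by
    rw [← ofReal_measureReal]
    refine ENNReal.ofReal_le_ofReal ((measureReal_union_le _ _).trans ?_)
    have e1 : μ.real bad₁ ≤ 1 / (2 / δ) := t₁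
    have e2 : μ.real bad₂ ≤ 1 / (6 / δ) := t₂
    rw [one_div_div] at e1 e2
    linarith
  -- The mean of `uniformDev` is at most `2LK`; the sign of `LK` permits enlarging this to the `8LK`
  -- and `4LK` of the stated bounds.
  have hK : 0 ≤ L * rademacherSum P 𝒢 a np nn nu := by
    have h2 := hπ 1
    have h3 := hπ (-1)
    have h4 := ha.1
    have h5 := sub_pos.2 ha.2
    have hR := fun n q => rademacher_nonneg hCg hne n q
    have := hR nn (classLaw P (-1))
    have := hR np (classLaw P 1)
    have := hR nu (marginal P)
    unfold rademacherSum
    positivity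
  -- The exceptional set need not be measurable, so it is replaced by its measurable hull.
  refine ⟨(toMeasurable μ (bad₁ ∪ bad₂))ᶜ, (measurableSet_toMeasurable _ _).compl, ?_,
    fun S hS g hg => ?_⟩
  · rw [prob_compl_eq_one_sub (measurableSet_toMeasurable _ _), measure_toMeasurable,
      ENNReal.ofReal_sub _ hδ.le, ENNReal.ofReal_one]
    gcongr
  · have hS' : S ∉ bad₁ ∪ bad₂ := fun h => hS (subset_toMeasurable _ _ h)
    have hS₁ : f₁ S < _ := not_le.1 fun h => hS' (Or.inl h)
    have hS₂ : f₂ S < _ := not_le.1 fun h => hS' (Or.inr h)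
    -- For both estimators the risk of `g` is at most `uniformDev` plus the empirical risk of `g`,
    -- hence at most `uniformDev` plus that of `gstar`, which is the statistic controlled off the
    -- bad set.
    have hrisk := risk_le_empRisk2_add_uniformDev hπ ha hcont hC hsup hnp hnn hnu hg (hmeas g hg) S
    refine ⟨fun ρ hρ hgρ hle => ?_, fun hle => ?_⟩
    · have hbias := integral_empRisk1_le (np := np) hπ hlm hC ha hnp hnn hnu hgm hρ hgρ
      have h12 := empRisk2_le_empRisk1 (P := P) (ℓ := ℓ) ha.1.le S g
      have hε : 0 ≤ biasTerm P a C ρ nn nu := by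
        have h2 := hπ (-1)
        have h3 := ha.1
        unfold biasTerm
        positivity
      rw [bound1]
      simp only [hf₁] at hS₁ hmean₁
      linarith
    · rw [bound2]
      simp only [hf₂] at hS₂ hmean₂
      linarith

end UniformDeviation

/-! ### Reduction to a globally bounded Lipschitz loss -/

/-- The loss of the output truncated to `[-B, B]`. -/
def truncatedLoss (ℓ : Loss) {B : ℝ} (hB : -B ≤ B) : Loss := fun t y => ℓ (projIcc (-B) B hB t) y

lemma truncatedLoss_eq (ℓ : Loss) {B : ℝ} (hB : -B ≤ B) {t : ℝ} (ht : |t| ≤ B) :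
    truncatedLoss ℓ hB t = ℓ t := by
  funext y
  rw [truncatedLoss, projIcc_of_mem hB (abs_le.1 ht)]

lemma abs_projIcc_le {B : ℝ} (hB : -B ≤ B) (t : ℝ) : |(projIcc (-B) B hB t : ℝ)| ≤ B :=
  abs_le.2 (projIcc (-B) B hB t).2

lemma abs_truncatedLoss_sub_le {ℓ : Loss} {B : ℝ} (hB : -B ≤ B) {L : ℝ≥0}
    (hlip : ∀ y, LipschitzOnWith L (fun t => ℓ t y) {t | |t| ≤ B}) (y : ℤˣ) (s t : ℝ) :
    |truncatedLoss ℓ hB s y - truncatedLoss ℓ hB t y| ≤ L * |s - t| := by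
  refine ((hlip y).dist_le_mul _ (abs_projIcc_le hB s) _ (abs_projIcc_le hB t)).trans ?_
  have h := (LipschitzWith.projIcc hB).dist_le_mul s t
  rw [NNReal.coe_one, one_mul] at h
  exact mul_le_mul_of_nonneg_left h L.2

section Transfer

variable {X : Type*} [MeasurableSpace X] {P : Measure (X × ℤˣ)} {ℓ ℓ' : Loss} {g : X → ℝ}

lemma risk_congr (h : ∀ x, ℓ (g x) = ℓ' (g x)) : risk P ℓ g = risk P ℓ' g := by
  unfold risk; simp only [h]

lemma partialRisk_congr (h : ∀ x, ℓ (g x) = ℓ' (g x)) (q : Measure X) (y : ℤˣ) :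
    partialRisk q ℓ y g = partialRisk q ℓ' y g := by
  unfold partialRisk; simp only [h]

lemma empRisk1_congr (h : ∀ x, ℓ (g x) = ℓ' (g x)) (a : ℝ) {np nn nu : ℕ}
    (S : Samples X np nn nu) : empRisk1 P ℓ a S g = empRisk1 P ℓ' a S g := by
  unfold empRisk1 empMean; simp only [h]

lemma empRisk2_congr (h : ∀ x, ℓ (g x) = ℓ' (g x)) (a : ℝ) {np nn nu : ℕ}
    (S : Samples X np nn nu) : empRisk2 P ℓ a S g = empRisk2 P ℓ' a S g := by
  unfold empRisk2 empMean; simp only [h]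

end Transfer

end SemiAD

end

/-! ### The main theorem -/

theorem mainTheorem5 (ℓ : SemiAD.Loss)
    (hmeas : ∀ y, Measurable fun t => ℓ t y) (hnonneg : ∀ t y, 0 ≤ ℓ t y)
    (hcal : SemiAD.ClassificationCalibrated ℓ) :
    ∃ ψ : ℝ → ℝ,
      ConvexOn ℝ (Ici 0) ψ ∧ MonotoneOn ψ (Ici 0) ∧ BijOn ψ (Ici 0) (Ici 0) ∧ ψ 0 = 0 ∧
      ∀ (d : ℕ) (P : Measure (EuclideanSpace ℝ (Fin d) × ℤˣ)) [IsProbabilityMeasure P],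
        (∀ y, 0 < SemiAD.prior P y) →
      ∀ (𝒢 : Set (EuclideanSpace ℝ (Fin d) → ℝ)) (Cg Cl : ℝ) (L : ℝ≥0),
        (∀ g ∈ 𝒢, Measurable g ∧ ∀ x, |g x| ≤ Cg) →
        SemiAD.MeasurableSuprema 𝒢 →
        0 < Cl → (∀ t y, |t| ≤ Cg → ℓ t y ≤ Cl) →
        (∀ y, LipschitzOnWith L (fun t => ℓ t y) {t | |t| ≤ Cg}) →
      ∀ gstar ∈ 𝒢, IsMinOn (SemiAD.risk P ℓ) 𝒢 gstar →
      ∀ a ∈ Ioo (0 : ℝ) 1, ∀ np nn nu : ℕ, 0 < np → 0 < nn → 0 < nu → ∀ δ : ℝ, 0 < δ →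
      ∃ E : Set (SemiAD.Samples (EuclideanSpace ℝ (Fin d)) np nn nu),
        MeasurableSet E ∧ ENNReal.ofReal (1 - δ) ≤ SemiAD.sampleLaw P np nn nu E ∧
        ∀ S ∈ E,
          ((∀ g ∈ 𝒢, -g ∈ 𝒢) →
            ∀ ρ : ℝ, 0 < ρ → (∀ g ∈ 𝒢, ρ ≤ SemiAD.partialRisk (SemiAD.classLaw P 1) ℓ 1 g) →
            ∀ ghat ∈ 𝒢, IsMinOn (SemiAD.empRisk1 P ℓ a S) 𝒢 ghat →
              SemiAD.ExcessZeroOneRiskLE P ghat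
                (Function.invFunOn ψ (Ici 0)
                  (SemiAD.bound1 P 𝒢 a Cl L ρ δ np nn nu + SemiAD.excessRisk P ℓ gstar))) ∧
          (∀ ghat ∈ 𝒢, IsMinOn (SemiAD.empRisk2 P ℓ a S) 𝒢 ghat →
              SemiAD.ExcessZeroOneRiskLE P ghat
                (Function.invFunOn ψ (Ici 0)
                  (SemiAD.bound2 P 𝒢 a Cl L δ np nn nu + SemiAD.excessRisk P ℓ gstar))) := by
  obtain ⟨ψ, hconv, hmono, hcont, hbij, hψ0, hψ⟩ :=
    SemiAD.exists_calibration_function hnonneg hcal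
  refine ⟨ψ, hconv, hmono.monotoneOn, hbij, hψ0, ?_⟩
  intro d P _ hπ 𝒢 Cg Cl L h𝒢 hsup hCl hℓCl hlip gstar hgstar _ a ha np nn nu hnp hnn hnu δ hδ
  have hCg : -Cg ≤ Cg := by
    have := (abs_nonneg _).trans ((h𝒢 gstar hgstar).2 0)
    linarith
  have htrunc : ∀ g ∈ 𝒢, ∀ x, SemiAD.truncatedLoss ℓ hCg (g x) = ℓ (g x) := fun g hg x =>
    SemiAD.truncatedLoss_eq ℓ hCg ((h𝒢 g hg).2 x)
  have hfin : ∀ g ∈ 𝒢, SemiAD.risk P ℓ g ≠ ∞ := fun g hg =>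
    SemiAD.risk_ne_top fun x y => hℓCl _ y ((h𝒢 g hg).2 x)
  -- The estimation bound is applied to the truncated loss, which agrees with `ℓ` on all values
  -- taken by the class. The calibration inequality is applied to `ℓ` itself, so `ψ` does not depend
  -- on `Cg`.
  obtain ⟨E, hEm, hE, hES⟩ := SemiAD.exists_event_estimation (np := np) (nn := nn) (nu := nu)
    (ℓ := SemiAD.truncatedLoss ℓ hCg) (L := (L : ℝ)) hπ ha hCl
    (fun t y => ⟨hnonneg _ _, hℓCl _ y (SemiAD.abs_projIcc_le hCg t)⟩) L.coe_nonneg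
    (SemiAD.abs_truncatedLoss_sub_le hCg hlip) hsup (fun g hg => (h𝒢 g hg).1)
    (fun g hg => (h𝒢 g hg).2) hgstar hnp hnn hnu hδ
  refine ⟨E, hEm, hE, fun S hS => ⟨fun _ ρ hρ h𝒢ρ ghat hghat hmin => ?_, fun ghat hghat hmin => ?_⟩⟩
  · refine SemiAD.excessZeroOneRiskLE_of_excessRisk_le hmeas hnonneg hconv hmono hcont hbij hψ0 hψ
      (h𝒢 ghat hghat).1 (hfin ghat hghat) ?_
    have h := (hES S hS ghat hghat).1 ρ hρ
      (by rw [SemiAD.partialRisk_congr (htrunc gstar hgstar)]; exact h𝒢ρ gstar hgstar)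
      (by
        rw [SemiAD.empRisk1_congr (htrunc ghat hghat), SemiAD.empRisk1_congr (htrunc gstar hgstar)]
        exact hmin hgstar)
    rw [SemiAD.risk_congr (htrunc ghat hghat), SemiAD.risk_congr (htrunc gstar hgstar)] at h
    unfold SemiAD.excessRisk
    linarith
  · refine SemiAD.excessZeroOneRiskLE_of_excessRisk_le hmeas hnonneg hconv hmono hcont hbij hψ0 hψ
      (h𝒢 ghat hghat).1 (hfin ghat hghat) ?_
    have h := (hES S hS ghat hghat).2 (by
        rw [SemiAD.empRisk2_congr (htrunc ghat hghat), SemiAD.empRisk2_congr (htrunc gstar hgstar)]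
        exact hmin hgstar)
    rw [SemiAD.risk_congr (htrunc ghat hghat), SemiAD.risk_congr (htrunc gstar hgstar)] at h
    unfold SemiAD.excessRisk
    linarith
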